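/- **Definitions.** Let $\mathbb F$ be a field. The *algebraic rank* of a set of polynomials over $\mathbb F$ is the size of a maximal algebraically independent subset. A $\Sigma\Pi^{(k)}\Sigma\Pi^{[d]}$ circuit in $N$ variables over $\mathbb F$ is a representation $$P=\sum_{i=1}^{T} Q_{i1}Q_{i2}\cdots Q_{it}$$ of a polynomial $P\in\mathbb F[X_1,\dots,X_N]$, for some $T,t$, such that every $Q_{ij}$ has degree at most $d$ and, for each $i$, the set $\{Q_{ij}: 1\le j\le t\}$ has algebraic rank at most $k$. Its *size* is the maximum of $T$ and the number of monomials that occur with nonzero coefficient in at least one $Q_{ij}$. Logarithms are natural. **Theorem 1.8.** There is an absolute constant $B\in\mathbb N$ such that for every polynomial $p$ with natural number coefficients there are a constant $A$ (depending only on $p$) and, for every $N\ge 0$, a finite list $H_N$ of points of $\mathbb N^N$ with the following properties. 1. (Hitting set.) Let $\mathbb F$ be any field of characteristic zero, let $N\ge 0$, and let $\mathcal H_N\subseteq\mathbb F^N$ be the image of $H_N$ under $\mathbb N\to\mathbb F$. If $P\in\mathbb F[X_1,\dots,X_N]$ is a nonzero polynomial of degree at most $p(N)$ that is computed by a $\Sigma\Pi^{(k)}\Sigma\Pi^{[d]}$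 circuit of size at most $p(N)$, where $k,d\in\mathbb N$ satisfy $d,k\le\log N$ (for $N=0$: $d=k=0$), then $P(h)\ne 0$ for some $h\in\mathcal H_N$. For every $N\ge 2$, $$|\mathcal H_N|\le\exp\bigl(A\,(\log N)^{B}\bigr).$$ 2. (Explicitness.) There is a deterministic multi-stack Turing machine, depending only on $p$, which for every $N$, on input $N$ written in unary, outputs the list $H_N$ (coordinates in binary). For every $N\ge 2$ it does so within $\exp\bigl(A\,(\log N)^{B}\bigr)$ steps. -/

import Mathlib

open Computability

/-! ### Circuits -/

/-- The algebraic rank over `F` of a set `S` of `N`-variate polynomials: the size of a maximal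
algebraically independent subset of `S`, i.e. the rank of `S` in the matroid whose independent sets
are the algebraically independent sets. -/
noncomputable def algRank {F : Type*} [Field F] {N : ℕ} (S : Set (MvPolynomial (Fin N) F)) : ℕ∞ :=
  (AlgebraicIndependent.matroid F (MvPolynomial (Fin N) F)).eRk S

/-- A depth-4 circuit `∑_{i < T} ∏_{j < t} Q i j` over `F` in `N` variables, whose bottom
polynomials `Q i j` are given by their monomial expansion. -/
structure Depth4Circuit (F : Type*) [Field F] (N : ℕ) where
  T : ℕ
  t : ℕ
  Q : Fin T → Fin t → MvPolynomial (Fin N) F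

namespace Depth4Circuit

variable {F : Type*} [Field F] {N : ℕ}

/-- The polynomial computed by the circuit. -/
noncomputable def poly (C : Depth4Circuit F N) : MvPolynomial (Fin N) F :=
  ∑ i, ∏ j, C.Q i j

/-- For every product gate, the set of its inputs has algebraic rank at most `k`. -/
def RankLE (C : Depth4Circuit F N) (k : ℕ) : Prop :=
  ∀ i, algRank (Set.range (C.Q i)) ≤ k

/-- All bottom polynomials have degree at most `d`. -/
def BottomDegLE (C : Depth4Circuit F N) (d : ℕ) : Prop :=
  ∀ i j, (C.Q i j).totalDegree ≤ d

open Classical in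
/-- The size of a circuit: the maximum of the top fan-in `T` and the number of monomials that occur
in at least one of the `Q i j`. -/
noncomputable def size (C : Depth4Circuit F N) : ℕ :=
  max C.T (Finset.univ.biUnion fun i => Finset.univ.biUnion fun j => (C.Q i j).support).card

end Depth4Circuit

/-- The polynomials computed by `ΣΠ^(k)ΣΠ^[d]` circuits of size at most `s`. -/
def sigmaPiSigmaPi (F : Type*) [Field F] (N k d s : ℕ) : Set (MvPolynomial (Fin N) F) :=
  {P | ∃ C : Depth4Circuit F N, C.RankLE k ∧ C.BottomDegLE d ∧ C.size ≤ s ∧ C.poly = P}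

/-! ### Hitting sets -/

/-- `H` is a hitting set for the class `S` of polynomials. -/
def IsHittingSet {F : Type*} [Field F] {N : ℕ} (H : Set (Fin N → F))
    (S : Set (MvPolynomial (Fin N) F)) : Prop :=
  ∀ P ∈ S, P ≠ 0 → ∃ h ∈ H, MvPolynomial.eval h P ≠ 0

open Classical in
/-- The set of points of `F ^ N` given by a list of points with natural number coordinates. -/
noncomputable def pointSet (F : Type*) [Field F] {N : ℕ} (L : List (Fin N → ℕ)) :
    Finset (Fin N → F) :=
  (L.map fun x i => (x i : F)).toFinset

/-! ### Writing lists of points as words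

The alphabet is the standard finite one, `Computability.Γ'`. A coordinate is written in binary
(`Computability.encodeNat`) and followed by `comma`; a point is the sequence of its coordinates
followed by `ket`; a list of points is the concatenation of its points. -/

/-- The word for one coordinate. -/
def encodeCoord (n : ℕ) : List Γ' := (encodeNat n).map Γ'.bit ++ [Γ'.comma]

/-- The word for one point. -/
def encodePoint (x : List ℕ) : List Γ' := x.flatMap encodeCoord ++ [Γ'.ket]

/-- The word for a list of points. -/
def encodePoints (L : List (List ℕ)) : List Γ' := L.flatMap encodePoint

theorem encodeCoord_prefix_free {m n : ℕ} {u v : List Γ'}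
    (h : encodeCoord m ++ u = encodeCoord n ++ v) : m = n ∧ u = v := by
  have key : ∀ (a b : List Bool), a.map Γ'.bit ++ (Γ'.comma :: u) = b.map Γ'.bit ++
      (Γ'.comma :: v) → a = b ∧ u = v := by
    intro a
    induction a with
    | nil => intro b hb; cases b <;> simp_all
    | cons x a ih =>
      intro b hb
      cases b with
      | nil => simp at hb
      | cons y b =>
        simp only [List.map_cons, List.cons_append, List.cons.injEq, Γ'.bit.injEq] at hb
        obtain ⟨h1, h2⟩ := ih b hb.2
        exact ⟨by rw [hb.1, h1], h2⟩
  obtain ⟨h1, h2⟩ := key _ _ (by simpa [encodeCoord] using h)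
  exact ⟨encodingNatBool.encode_injective h1, h2⟩

theorem encodePoint_prefix_free {x y : List ℕ} {u v : List Γ'}
    (h : encodePoint x ++ u = encodePoint y ++ v) : x = y ∧ u = v := by
  have hne : ∀ (n : ℕ) (w w' : List Γ'), encodeCoord n ++ w ≠ Γ'.ket :: w' := by
    intro n w w' hw
    unfold encodeCoord at hw
    cases hc : encodeNat n <;> simp [hc] at hw
  induction x generalizing y with
  | nil =>
    cases y with
    | nil => simpa [encodePoint] using h
    | cons n y =>
      refine absurd h.symm ?_
      simpa [encodePoint, List.append_assoc] using hne n _ _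
  | cons m x ih =>
    cases y with
    | nil =>
      refine absurd h ?_
      simpa [encodePoint, List.append_assoc] using hne m _ _
    | cons n y =>
      obtain ⟨h1, h2⟩ := encodeCoord_prefix_free (m := m) (n := n)
        (u := encodePoint x ++ u) (v := encodePoint y ++ v)
        (by simpa [encodePoint, List.append_assoc] using h)
      obtain ⟨h3, h4⟩ := ih h2
      exact ⟨by rw [h1, h3], h4⟩

/-- A list of points can be read off from its word. -/
theorem encodePoints_injective : Function.Injective encodePoints := by
  have hne : ∀ x w, encodePoint x ++ w ≠ [] := by simp [encodePoint]
  intro L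
  induction L with
  | nil =>
    intro L' h
    cases L' with
    | nil => rfl
    | cons y L' => exact absurd h.symm (hne y _)
  | cons x L ih =>
    intro L' h
    cases L' with
    | nil => exact absurd h (hne x _)
    | cons y L' =>
      obtain ⟨h1, h2⟩ := encodePoint_prefix_free (x := x) (y := y)
        (u := encodePoints L) (v := encodePoints L') (by simpa [encodePoints] using h)
      rw [h1, ih h2]

/-! A nonzero `P` with such a circuit has a monomial in few variables. The argument is that of
shifted partial derivatives. In characteristic zero an element `f` algebraic over `F(q)` satisfies
`D f = ∑ c_b * D (q b)` for every derivation `D`, with coefficients `c_b` again algebraic over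
`F(q)`. Taking for `q` a transcendence basis of at most `k` inputs of a product gate, all
derivatives of order `n` of that gate lie in the span of at most `(k+1)^n` elements multiplied by
polynomials of degree at most `n*d`. Hence the products of these derivatives of `P` with monomials
of degree at most `ℓ` span a small space (`Depth4Circuit.exists_polySpan_pderiv`).

If the leading monomial of `P` had large support, deriving along `n`-subsets `A` of the support and
shifting by monomials off `A` would give too many distinct leading exponents
(`Depth4Circuit.choose_mul_choose_le`). With `ℓ = N*(d+1)` this is a contradiction
(`Depth4Circuit.exists_small_support`). Setting all variables outside a small support to zero keeps
`P` nonzero, and the Combinatorial Nullstellensatz yields a nonzero value at a sparse point with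
entries at most the degree (`exists_sparse_point`).

With `L = digitCount c N = O(log N)` binary digits per coordinate, these points have at most `L^3`
nonzero coordinates, hence at most `L^4` one bits. The hitting set consists of all points whose
binary words have at most `L^4` ones. There are at most `(N*(L+1)+1)^(L^4) = exp(O((log N)^5))` of
them, and a machine lists them by backtracking in comparable time. -/

/-! ### Partial derivatives of algebraic elements -/

/-- The elements algebraic over the subfield generated by a family `q`. -/
noncomputable def algHull (F : Type*) {K ι : Type*} [Field F] [Field K] [Algebra F K] (q : ι → K) :
    IntermediateField F K :=
  (algebraicClosure (IntermediateField.adjoin F (Set.range q)) K).restrictScalars F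

section Partials

variable {F K ι : Type*} [Field F] [Field K] [Algebra F K]

theorem mem_algHull {q : ι → K} {f : K} :
    f ∈ algHull F q ↔ IsAlgebraic (IntermediateField.adjoin F (Set.range q)) f := by
  simp [algHull, IntermediateField.mem_restrictScalars, mem_algebraicClosure_iff]

theorem adjoin_le_algHull (q : ι → K) :
    IntermediateField.adjoin F (Set.range q) ≤ algHull F q := by
  intro f hf
  rw [mem_algHull]
  exact isAlgebraic_algebraMap (⟨f, hf⟩ : IntermediateField.adjoin F (Set.range q))

variable [Fintype ι]

/-- `f` has partial derivatives with respect to the family `q` lying in `E`. -/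
def HasPartials (E : IntermediateField F K) (q : ι → K) (f : K) : Prop :=
  ∃ c : ι → K, (∀ b, c b ∈ E) ∧ ∀ D : Derivation F K K, D f = ∑ b, c b * D (q b)

/-- The elements of `E` with partial derivatives in `E` form an intermediate field. -/
def partialsField (E : IntermediateField F K) (q : ι → K) : IntermediateField F K where
  carrier := {f | f ∈ E ∧ HasPartials E q f}
  mul_mem' := by
    rintro f g ⟨hf, c, hc, hcf⟩ ⟨hg, e, he, hcg⟩
    refine ⟨mul_mem hf hg, fun b => f * e b + g * c b,
      fun b => add_mem (mul_mem hf (he b)) (mul_mem hg (hc b)), fun D => ?_⟩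
    simp only [Derivation.leibniz, smul_eq_mul, hcf, hcg, Finset.mul_sum, add_mul,
      Finset.sum_add_distrib, mul_assoc]
  one_mem' := ⟨one_mem E, 0, fun _ => zero_mem E, by simp⟩
  add_mem' := by
    rintro f g ⟨hf, c, hc, hcf⟩ ⟨hg, e, he, hcg⟩
    refine ⟨add_mem hf hg, fun b => c b + e b, fun b => add_mem (hc b) (he b), fun D => ?_⟩
    simp [hcf, hcg, add_mul, Finset.sum_add_distrib]
  zero_mem' := ⟨zero_mem E, 0, fun _ => zero_mem E, by simp⟩
  algebraMap_mem' := fun a => ⟨E.algebraMap_mem a, 0, fun _ => zero_mem E, by simp⟩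
  inv_mem' := by
    rintro f ⟨hf, c, hc, hcf⟩
    refine ⟨inv_mem hf, fun b => -f⁻¹ ^ 2 * c b,
      fun b => mul_mem (neg_mem (pow_mem (inv_mem hf) 2)) (hc b), fun D => ?_⟩
    simp [Derivation.leibniz_inv, hcf, Finset.mul_sum, mul_assoc]

/-- Since `partialsField` is a field, only the generators matter, and their partial derivatives are
Kronecker deltas. -/
theorem adjoin_le_partialsField (q : ι → K) :
    IntermediateField.adjoin F (Set.range q) ≤ partialsField (algHull F q) q := by
  classical
  rw [IntermediateField.adjoin_le_iff]
  rintro _ ⟨b, rfl⟩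
  refine ⟨adjoin_le_algHull q (IntermediateField.subset_adjoin F _ ⟨b, rfl⟩),
    fun b' => if b' = b then 1 else 0, fun b' => ?_, fun D => by simp⟩
  dsimp only
  split_ifs
  exacts [one_mem _, zero_mem _]

/-- The chain rule; the first summand collects the derivatives of the coefficients, on which `D`
need not vanish. -/
theorem derivation_aeval {A : IntermediateField F K} (D : Derivation F K K) (p : Polynomial A)
    (f : K) : D (Polynomial.aeval f p) =
      p.sum (fun i a => f ^ i * D (a : K)) + Polynomial.aeval f p.derivative * D f := by
  induction p using Polynomial.induction_on' with
  | add p q hp hq =>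
    rw [Polynomial.sum_add_index _ _ _ (by simp) (by simp [mul_add])]
    simp only [map_add, hp, hq, add_mul]
    ring
  | monomial n a =>
    rw [Polynomial.sum_monomial_index _ _ (by simp)]
    simp only [Polynomial.aeval_monomial, Derivation.leibniz, Derivation.leibniz_pow,
      Polynomial.derivative_monomial, smul_eq_mul, nsmul_eq_mul, map_mul, map_natCast]
    change (a : K) * _ + _ * D (a : K) = _ + (a : K) * _ * _ * _
    ring

/-- In characteristic zero, elements algebraic over `F(q)` have partial derivatives with respect to
`q` that are again algebraic over `F(q)`. -/
theorem hasPartials_of_mem_algHull [CharZero F] (q : ι → K) {f : K} (hf : f ∈ algHull F q) :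
    HasPartials (algHull F q) q f := by
  have hint : IsIntegral (IntermediateField.adjoin F (Set.range q)) f :=
    (mem_algHull.1 hf).isIntegral
  set p := minpoly (IntermediateField.adjoin F (Set.range q)) f with hp
  have : CharZero (IntermediateField.adjoin F (Set.range q)) :=
    charZero_of_injective_algebraMap (algebraMap F _).injective
  have hsep : Polynomial.aeval f p.derivative ≠ 0 :=
    (minpoly.irreducible hint).separable.aeval_derivative_ne_zero (minpoly.aeval _ f)
  choose c hc hcD using fun i => (adjoin_le_partialsField q (p.coeff i).2).2
  have hmem : ∀ r : Polynomial (IntermediateField.adjoin F (Set.range q)),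
      Polynomial.aeval f r ∈ algHull F q := fun r => by
    rw [Polynomial.aeval_eq_sum_range]
    refine sum_mem fun i _ => ?_
    rw [Algebra.smul_def]
    exact mul_mem (adjoin_le_algHull q (r.coeff i).2) (pow_mem hf i)
  refine ⟨fun b => -(Polynomial.aeval f p.derivative)⁻¹ * ∑ i ∈ p.support, f ^ i * c i b,
    fun b => mul_mem (neg_mem (inv_mem (hmem _)))
      (sum_mem fun i _ => mul_mem (pow_mem hf i) (hc i b)), fun D => ?_⟩
  -- Differentiating `p(f) = 0` gives a linear equation for `D f`. It can be solved because
  -- separability makes `p'(f)` nonzero.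
  have h := derivation_aeval D p f
  rw [minpoly.aeval, map_zero, Polynomial.sum_def] at h
  have h2 : D f = -(Polynomial.aeval f p.derivative)⁻¹ *
      ∑ i ∈ p.support, f ^ i * D (p.coeff i : K) := by
    field_simp
    linear_combination -h
  rw [h2]
  simp only [hcD, Finset.mul_sum, Finset.sum_mul]
  rw [Finset.sum_comm]
  exact Finset.sum_congr rfl fun b _ => Finset.sum_congr rfl fun i _ => by ring

end Partials

/-- Derivations extend to the field of fractions. -/
theorem exists_derivation_extending {F R K : Type*} [Field F] [CommRing R] [IsDomain R] [Algebra F R]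
    [Field K] [Algebra F K] [Algebra R K] [IsScalarTower F R K] [IsFractionRing R K]
    (d : Derivation F R R) :
    ∃ D : Derivation F K K, ∀ a, D (algebraMap R K a) = algebraMap R K (d a) := by
  -- A localization is formally étale, so the differentials of `K` are the base change of those of
  -- `R` and a derivation extends linearly.
  have : Algebra.FormallyEtale R K := Algebra.FormallyEtale.of_isLocalization (nonZeroDivisors R)
  let e := KaehlerDifferential.tensorKaehlerEquivOfFormallyEtale F R K
  let φ : Ω[R⁄F] →ₗ[R] K := (Algebra.linearMap R K).comp d.liftKaehlerDifferential
  let ψ : TensorProduct R K Ω[R⁄F] →ₗ[K] K := φ.liftBaseChange K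
  refine ⟨(ψ.comp e.symm.toLinearMap).compDer (KaehlerDifferential.D F K), fun a => ?_⟩
  have := KaehlerDifferential.tensorKaehlerEquivOfFormallyEtale_symm_D_algebraMap F R K a
  simp [e, ψ, φ, this]

open MvPolynomial

/-! ### Shifted partial derivatives: the upper bound -/

section Shifted

variable {F : Type*} [Field F] {N : ℕ}

theorem totalDegree_pderiv_le' (s : Fin N) (g : MvPolynomial (Fin N) F) :
    (pderiv s g).totalDegree ≤ g.totalDegree := by
  refine Finset.sup_le fun ν hν => ?_
  rw [mem_support_iff, coeff_pderiv] at hν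
  have h := le_totalDegree (mem_support_iff.2 (left_ne_zero_of_mul hν))
  refine le_trans ?_ h
  rw [Finsupp.sum_add_index' (by simp) (by simp)]
  exact Nat.le_add_right _ _

/-- The iterated partial derivative along a list of variables. -/
noncomputable def iterPderiv (l : List (Fin N)) (f : MvPolynomial (Fin N) F) :
    MvPolynomial (Fin N) F :=
  l.foldr (fun s g => pderiv s g) f

theorem iterPderiv_cons (s : Fin N) (l : List (Fin N)) (f : MvPolynomial (Fin N) F) :
    iterPderiv (s :: l) f = pderiv s (iterPderiv l f) := rfl

theorem iterPderiv_sum {ι : Type*} (l : List (Fin N)) (t : Finset ι)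
    (f : ι → MvPolynomial (Fin N) F) :
    iterPderiv l (∑ i ∈ t, f i) = ∑ i ∈ t, iterPderiv l (f i) := by
  induction l with
  | nil => rfl
  | cons s l ih => simp only [iterPderiv_cons, ih, map_sum]

/-- The exponents of degree at most `e` that are supported on `s`. -/
noncomputable def expsLE (s : Finset (Fin N)) (e : ℕ) : Finset (Fin N →₀ ℕ) :=
  (Finset.range (e + 1)).biUnion fun j => s.finsuppAntidiag j

theorem mem_expsLE {s : Finset (Fin N)} {e : ℕ} {γ : Fin N →₀ ℕ} :
    γ ∈ expsLE s e ↔ γ.degree ≤ e ∧ γ.support ⊆ s := by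
  simp only [expsLE, Finset.mem_biUnion, Finset.mem_range, Finset.mem_finsuppAntidiag]
  constructor
  · rintro ⟨j, hj, h, hs⟩
    refine ⟨?_, hs⟩
    rw [Finsupp.degree_eq_sum, ← Finset.sum_subset (Finset.subset_univ s)]
    · have : ∑ x ∈ s, γ x = j := h
      omega
    · exact fun x _ hx => Finsupp.notMem_support_iff.1 fun h => hx (hs h)
  · rintro ⟨h, hs⟩
    refine ⟨_, Nat.lt_succ_of_le h, ?_, hs⟩
    rw [Finsupp.degree_eq_sum, ← Finset.sum_subset (Finset.subset_univ s)]
    exact fun x _ hx => Finsupp.notMem_support_iff.1 fun h => hx (hs h)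

/-- A slack variable turns degree at most `e` into degree exactly `e`; the proof sums the
multichoose numbers accordingly. -/
theorem card_expsLE (s : Finset (Fin N)) (e : ℕ) :
    (expsLE s e).card = (s.card + e).choose e := by
  rw [expsLE, Finset.card_biUnion]
  · simp only [Finset.card_finsuppAntidiag_nat_eq_multichoose]
    have : ∀ e, ∑ j ∈ Finset.range (e + 1), s.card.multichoose j = (s.card + 1).multichoose e := by
      intro e
      induction e with
      | zero => simp
      | succ e ih => rw [Finset.sum_range_succ, ih, Nat.multichoose_succ_succ, add_comm]
    rw [this, Nat.multichoose_eq]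
    congr 1
    omega
  · intro i _ j _ hij
    refine Finset.disjoint_left.2 fun γ h1 h2 => hij ?_
    rw [Finset.mem_finsuppAntidiag] at h1 h2
    rw [← h1.1, ← h2.1]

variable {K : Type*} [Field K] [Algebra F K] [Algebra (MvPolynomial (Fin N) F) K]
  [IsScalarTower F (MvPolynomial (Fin N) F) K]

/-- The span of all products of a polynomial of degree at most `e` and an element of `W`. -/
noncomputable def polySpan (F : Type*) [Field F] (N : ℕ) {K : Type*} [Field K] [Algebra F K]
    [Algebra (MvPolynomial (Fin N) F) K] (e : ℕ) (W : Set K) : Submodule F K :=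
  Submodule.span F {x | ∃ g : MvPolynomial (Fin N) F, g.totalDegree ≤ e ∧
    ∃ w ∈ W, x = algebraMap _ K g * w}

omit [IsScalarTower F (MvPolynomial (Fin N) F) K] in
theorem mul_mem_polySpan {e : ℕ} {W : Set K} {g : MvPolynomial (Fin N) F} {w : K}
    (hg : g.totalDegree ≤ e) (hw : w ∈ W) : algebraMap _ K g * w ∈ polySpan F N e W :=
  Submodule.subset_span ⟨g, hg, w, hw, rfl⟩

omit [IsScalarTower F (MvPolynomial (Fin N) F) K] in
theorem polySpan_mono {e e' : ℕ} {W W' : Set K} (he : e ≤ e') (hW : W ⊆ W') :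
    polySpan F N e W ≤ polySpan F N e' W' :=
  Submodule.span_mono fun _ ⟨g, hg, w, hw, hx⟩ => ⟨g, hg.trans he, w, hW hw, hx⟩

omit [IsScalarTower F (MvPolynomial (Fin N) F) K] in
theorem mul_mem_polySpan_of_mem {e e' : ℕ} {W : Set K} {h : MvPolynomial (Fin N) F} {x : K}
    (hh : h.totalDegree ≤ e) (hx : x ∈ polySpan F N e' W) :
    algebraMap _ K h * x ∈ polySpan F N (e + e') W := by
  induction hx using Submodule.span_induction with
  | mem x hx =>
    obtain ⟨g, hg, w, hw, rfl⟩ := hx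
    rw [← mul_assoc, ← map_mul]
    exact mul_mem_polySpan ((totalDegree_mul _ _).trans (add_le_add hh hg)) hw
  | zero => simp
  | add x y _ _ hx hy => rw [mul_add]; exact add_mem hx hy
  | smul a x _ hx => rw [mul_smul_comm]; exact Submodule.smul_mem _ _ hx

/-- Linearly independent polynomials in `polySpan F N e W` are few. -/
theorem card_le_of_mem_polySpan [IsFractionRing (MvPolynomial (Fin N) F) K] {ι : Type*} [Fintype ι]
    {v : ι → MvPolynomial (Fin N) F} (hv : LinearIndependent F v) {e : ℕ} {W : Finset K}
    (h : ∀ i, algebraMap _ K (v i) ∈ polySpan F N e (W : Set K)) :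
    Fintype.card ι ≤ (N + e).choose e * W.card := by
  classical
  let B : Finset K := Finset.image₂ (fun γ w => algebraMap _ K (monomial γ (1 : F)) * w)
    (expsLE (Finset.univ : Finset (Fin N)) e) W
  have hB : B.card ≤ (N + e).choose e * W.card := by
    refine (Finset.card_image₂_le _ _ _).trans ?_
    rw [card_expsLE, Finset.card_univ, Fintype.card_fin]
  refine le_trans ?_ hB
  have hsub : polySpan F N e (W : Set K) ≤ Submodule.span F (B : Set K) := by
    refine Submodule.span_le.2 ?_
    rintro _ ⟨g, hg, w, hw, rfl⟩
    rw [g.as_sum, map_sum, Finset.sum_mul]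
    refine Submodule.sum_mem _ fun γ hγ => ?_
    have : monomial γ (coeff γ g) = coeff γ g • monomial γ (1 : F) := by
      simp [smul_monomial]
    rw [this, Algebra.smul_def, map_mul, ← IsScalarTower.algebraMap_apply, mul_assoc,
      ← Algebra.smul_def]
    refine Submodule.smul_mem _ _ (Submodule.subset_span (Finset.mem_coe.2 ?_))
    exact Finset.mem_image₂_of_mem
      (mem_expsLE.2 ⟨(le_totalDegree hγ).trans hg, Finset.subset_univ _⟩) hw
  have hlin : LinearIndependent F fun i => algebraMap _ K (v i) :=
    hv.map' (IsScalarTower.toAlgHom F (MvPolynomial (Fin N) F) K).toLinearMap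
      (LinearMap.ker_eq_bot.2 (IsFractionRing.injective _ K))
  have := linearIndependent_le_span_aux' _ hlin (B : Set K)
    (by rintro _ ⟨i, rfl⟩; exact hsub (h i))
  simpa using this

/-- The derivatives of order `n` of a
polynomial algebraic over `k` polynomials of degree at most `d` lie in a small span. -/
theorem exists_polySpan_pderiv [IsFractionRing (MvPolynomial (Fin N) F) K] [CharZero F]
    {ι : Type*} [Fintype ι] {d : ℕ} {q : ι → MvPolynomial (Fin N) F}
    (hq : ∀ b, (q b).totalDegree ≤ d) {f : MvPolynomial (Fin N) F}
    (hf : algebraMap _ K f ∈ algHull F fun b => algebraMap _ K (q b)) (n : ℕ) :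
    ∃ W : Finset K, W.card ≤ (Fintype.card ι + 1) ^ n ∧
      (∀ w ∈ W, w ∈ algHull F fun b => algebraMap _ K (q b)) ∧
      ∀ l : List (Fin N), l.length = n →
        algebraMap _ K (iterPderiv l f) ∈ polySpan F N (n * d) (W : Set K) := by
  classical
  set E := algHull F fun b => algebraMap (MvPolynomial (Fin N) F) K (q b) with hE
  induction n with
  | zero =>
    refine ⟨{algebraMap _ K f}, by simp, by simpa using hf, fun l hl => ?_⟩
    rw [List.length_eq_zero_iff] at hl
    subst hl
    simpa [iterPderiv] using mul_mem_polySpan (F := F) (N := N) (K := K) (g := 1) (e := 0 * d)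
      (W := {algebraMap _ K f}) (by simp) rfl
  | succ n ih =>
    obtain ⟨W, hcard, hWE, hW⟩ := ih
    choose c hcE hcD using fun w : E => hasPartials_of_mem_algHull _ w.2
    -- The default `0` outside `E` is harmless, as `W` lies in `E`. By Leibniz, `D (g * w) = D g * w
    -- + ∑ (g * D (q b)) * c_b`, so one derivative adds at most `d` to the degree of the multiplier
    -- and only the elements `c_b` to `W`.
    let c' : K → ι → K := fun w b => if h : w ∈ E then c ⟨w, h⟩ b else 0
    let W' : Finset K := W ∪ Finset.univ.biUnion fun b => W.image fun w => c' w b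
    refine ⟨W', ?_, ?_, ?_⟩
    · refine (Finset.card_union_le _ _).trans ?_
      have h1 : (Finset.univ.biUnion fun b => W.image fun w => c' w b).card ≤
          Fintype.card ι * W.card :=
        Finset.card_biUnion_le_card_mul _ _ _ fun b _ => Finset.card_image_le
      calc _ ≤ W.card + Fintype.card ι * W.card := Nat.add_le_add_left h1 _
        _ = W.card * (Fintype.card ι + 1) := by ring
        _ ≤ _ := by rw [pow_succ]; gcongr
    · intro w hw
      simp only [W', Finset.mem_union, Finset.mem_biUnion, Finset.mem_image] at hw
      rcases hw with hw | ⟨b, -, w, hw, rfl⟩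
      · exact hWE w hw
      · have hwE := hWE w hw
        simp only [c', hwE, dif_pos]
        exact hcE _ b
    · intro l hl
      obtain ⟨s, l, rfl⟩ := List.exists_cons_of_length_eq_add_one hl
      obtain ⟨D, hD⟩ := exists_derivation_extending (K := K)
        (pderiv s : Derivation F (MvPolynomial (Fin N) F) (MvPolynomial (Fin N) F))
      rw [iterPderiv_cons, ← hD]
      have hl' := hW l (by simpa using hl)
      generalize algebraMap (MvPolynomial (Fin N) F) K (iterPderiv l f) = x at hl'
      induction hl' using Submodule.span_induction with
      | mem x hx =>
        obtain ⟨g, hg, w, hw, rfl⟩ := hx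
        have hwE := hWE w hw
        rw [Derivation.leibniz, smul_eq_mul, smul_eq_mul, hD, hcD ⟨w, hwE⟩ D, Finset.mul_sum,
          mul_comm w]
        refine add_mem (sum_mem fun b _ => ?_) ?_
        · have hmul : algebraMap _ K g * (c ⟨w, hwE⟩ b * D (algebraMap _ K (q b))) =
              algebraMap _ K (g * pderiv s (q b)) * c ⟨w, hwE⟩ b := by
            rw [hD, map_mul]
            ring
          rw [hmul]
          refine mul_mem_polySpan ((totalDegree_mul _ _).trans ?_) ?_
          · rw [add_mul, one_mul]
            exact add_le_add hg ((totalDegree_pderiv_le' _ _).trans (hq b))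
          · simp only [W', Finset.coe_union, Finset.coe_biUnion, Finset.coe_image]
            refine Or.inr (Set.mem_iUnion₂.2 ⟨b, Finset.mem_coe.2 (Finset.mem_univ _), w, hw, ?_⟩)
            simp only [c', hwE, dif_pos]
        · refine polySpan_mono ?_ ?_ (mul_mem_polySpan ((totalDegree_pderiv_le' s g).trans hg) hw)
          · gcongr
            omega
          · simp [W']
      | zero => simp
      | add x y _ _ hx hy => rw [map_add]; exact add_mem hx hy
      | smul a x _ hx => rw [Derivation.map_smul]; exact Submodule.smul_mem _ _ hx

/-- The iterated derivatives of order `n` of a sum of `T` products of polynomials of degree at most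
`d`, each product having algebraic rank at most `k`, lie in a small span. -/
theorem Depth4Circuit.exists_polySpan_pderiv [IsFractionRing (MvPolynomial (Fin N) F) K]
    [CharZero F] (C : Depth4Circuit F N) {k d : ℕ} (hk : C.RankLE k) (hd : C.BottomDegLE d)
    (n : ℕ) :
    ∃ W : Finset K, W.card ≤ C.T * (k + 1) ^ n ∧ ∀ l : List (Fin N), l.length = n →
        algebraMap _ K (iterPderiv l C.poly) ∈ polySpan F N (n * d) (W : Set K) := by
  classical
  have key : ∀ i, ∃ W : Finset K, W.card ≤ (k + 1) ^ n ∧ ∀ l : List (Fin N), l.length = n →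
      algebraMap _ K (iterPderiv l (∏ j, C.Q i j)) ∈ polySpan F N (n * d) (W : Set K) := by
    intro i
    -- A transcendence basis chosen among the inputs of the gate inherits their degree bound `d`.
    obtain ⟨I, hI⟩ := (AlgebraicIndependent.matroid F (MvPolynomial (Fin N) F)).exists_isBasis
      (Set.range (C.Q i)) (by simp)
    have hcard : I.encard ≤ k := by
      rw [hI.encard_eq_eRk]
      exact hk i
    have hfin : I.Finite := Set.finite_of_encard_le_coe hcard
    have : Fintype I := hfin.fintype
    have hcard' : Fintype.card I ≤ k := by
      rw [← Nat.card_eq_fintype_card, Nat.card_coe_set_eq]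
      exact_mod_cast (Set.Finite.cast_ncard_eq hfin).symm ▸ hcard
    rw [AlgebraicIndependent.matroid_isBasis_iff] at hI
    obtain ⟨-, hsub, halg⟩ := hI
    have hq : ∀ b : I, (b : MvPolynomial (Fin N) F).totalDegree ≤ d := by
      intro b
      obtain ⟨j, hj⟩ := hsub b.2
      rw [← hj]
      exact hd i j
    have hmem : ∀ j, algebraMap _ K (C.Q i j) ∈
        algHull F fun b : I => algebraMap _ K (b : MvPolynomial (Fin N) F) := by
      intro j
      rw [mem_algHull]
      set A := IntermediateField.adjoin F
        (Set.range fun b : I => algebraMap _ K (b : MvPolynomial (Fin N) F)) with hA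
      have hle : ∀ x : Algebra.adjoin F I, algebraMap _ K (x : MvPolynomial (Fin N) F) ∈ A := by
        rintro ⟨x, hx⟩
        induction hx using Algebra.adjoin_induction with
        | mem x hx => exact IntermediateField.subset_adjoin F _ ⟨⟨x, hx⟩, rfl⟩
        | algebraMap a =>
          rw [← IsScalarTower.algebraMap_apply]
          exact A.algebraMap_mem a
        | add x y _ _ hx hy => simpa using add_mem hx hy
        | mul x y _ _ hx hy => simpa using mul_mem hx hy
      -- Algebraicity over the polynomial subalgebra is carried along this injection to the subfield
      -- of `K`.
      let φ : Algebra.adjoin F I →+* A :=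
        ((algebraMap (MvPolynomial (Fin N) F) K).comp (Algebra.adjoin F I).subtype).codRestrict A hle
      refine (halg _ ⟨j, rfl⟩).ringHom_of_comp_eq φ (algebraMap (MvPolynomial (Fin N) F) K) ?_ rfl
      intro x y hxy
      exact Subtype.ext (IsFractionRing.injective _ K (congrArg Subtype.val hxy))
    obtain ⟨W, hW, -, hl⟩ := _root_.exists_polySpan_pderiv (K := K) hq (f := ∏ j, C.Q i j)
      (by rw [map_prod]; exact prod_mem fun j _ => hmem j) n
    exact ⟨W, hW.trans (by gcongr), hl⟩
  choose W hW hl using key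
  refine ⟨Finset.univ.biUnion W, ?_, fun l hlen => ?_⟩
  · exact (Finset.card_biUnion_le_card_mul _ _ _ fun i _ => hW i).trans (by simp)
  · rw [Depth4Circuit.poly, iterPderiv_sum, map_sum]
    exact sum_mem fun i _ => polySpan_mono le_rfl
      (Finset.coe_subset.2 (Finset.subset_biUnion_of_mem W (Finset.mem_univ i))) (hl i l hlen)

end Shifted

/-! ### Leading exponents: the lower bound -/

section Leading

variable {F : Type*} [Field F] {N : ℕ}

/-- `μ` is the leading exponent of `f`. -/
def IsLeadingExp (m : MonomialOrder (Fin N)) (f : MvPolynomial (Fin N) F) (μ : Fin N →₀ ℕ) : Prop :=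
  coeff μ f ≠ 0 ∧ ∀ ν, coeff ν f ≠ 0 → m.toSyn ν ≤ m.toSyn μ

variable {m : MonomialOrder (Fin N)} {f : MvPolynomial (Fin N) F}

theorem exists_isLeadingExp (m : MonomialOrder (Fin N)) (hf : f ≠ 0) : ∃ μ, IsLeadingExp m f μ := by
  obtain ⟨μ, hμ, h⟩ := f.support.exists_max_image m.toSyn (support_nonempty.2 hf)
  exact ⟨μ, mem_support_iff.1 hμ, fun ν hν => h ν (mem_support_iff.2 hν)⟩

/-- Terms of the derivative come from exponents raised by one in `s`, and the order is translation
invariant; characteristic zero keeps the leading coefficient nonzero. -/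
theorem IsLeadingExp.pderiv [CharZero F] {ν : Fin N →₀ ℕ} {s : Fin N}
    (h : IsLeadingExp m f (ν + Finsupp.single s 1)) :
    IsLeadingExp m (MvPolynomial.pderiv s f) ν := by
  refine ⟨?_, fun κ hκ => ?_⟩
  · rw [coeff_pderiv]
    exact mul_ne_zero h.1 (by exact Nat.cast_add_one_ne_zero _)
  · rw [coeff_pderiv] at hκ
    have := h.2 _ (left_ne_zero_of_mul hκ)
    rw [map_add, map_add] at this
    exact le_of_add_le_add_right this

theorem IsLeadingExp.iterPderiv [CharZero F] (l : List (Fin N)) {ν : Fin N →₀ ℕ}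
    (h : IsLeadingExp m f (ν + (l.map fun s => Finsupp.single s 1).sum)) :
    IsLeadingExp m (iterPderiv l f) ν := by
  induction l generalizing ν with
  | nil => simpa [_root_.iterPderiv] using h
  | cons s l ih =>
    rw [iterPderiv_cons]
    refine (ih ?_).pderiv
    rwa [List.map_cons, List.sum_cons, ← add_assoc] at h

theorem IsLeadingExp.monomial_mul {μ : Fin N →₀ ℕ} (h : IsLeadingExp m f μ) (γ : Fin N →₀ ℕ) :
    IsLeadingExp m (monomial γ 1 * f) (γ + μ) := by
  refine ⟨by rw [coeff_monomial_mul]; simpa using h.1, fun ν hν => ?_⟩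
  rw [coeff_monomial_mul'] at hν
  split_ifs at hν with hle
  · have := h.2 (ν - γ) (right_ne_zero_of_mul hν)
    rw [← add_tsub_cancel_of_le hle, map_add, map_add]
    exact add_le_add_right this _
  · exact absurd rfl hν

/-- In a vanishing combination, the largest leading exponent occurs in only one term and cannot
cancel. -/
theorem linearIndependent_of_isLeadingExp {ι : Type*} {v : ι → MvPolynomial (Fin N) F}
    {e : ι → Fin N →₀ ℕ} (he : Function.Injective e) (h : ∀ i, IsLeadingExp m (v i) (e i)) :
    LinearIndependent F v := by
  classical
  rw [linearIndependent_iff']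
  intro t c hc
  by_contra! hne
  obtain ⟨i₀, hi₀, hci₀⟩ := hne
  obtain ⟨i, hi, hmax⟩ := (t.filter fun i => c i ≠ 0).exists_max_image (fun i => m.toSyn (e i))
    ⟨i₀, Finset.mem_filter.2 ⟨hi₀, hci₀⟩⟩
  rw [Finset.mem_filter] at hi
  have h0 : coeff (e i) (∑ j ∈ t, c j • v j) = 0 := by rw [hc, coeff_zero]
  rw [coeff_sum, Finset.sum_eq_single_of_mem i hi.1] at h0
  · rw [coeff_smul, smul_eq_mul] at h0
    exact mul_ne_zero hi.2 (h i).1 h0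
  · intro j hj hji
    rw [coeff_smul, smul_eq_mul]
    by_contra hne
    have h1 := (h j).2 _ (right_ne_zero_of_mul hne)
    have h2 := hmax j (Finset.mem_filter.2 ⟨hj, left_ne_zero_of_mul hne⟩)
    exact hji (he (m.toSyn.injective (le_antisymm h2 h1)))

/-- The exponent of the product of a set of variables. -/
theorem sum_single_apply (A : Finset (Fin N)) (s : Fin N) :
    (A.toList.map fun s => Finsupp.single s 1).sum s = if s ∈ A then 1 else 0 := by
  classical
  rw [Finset.sum_map_toList, Finsupp.finsetSum_apply]
  simp [Finsupp.single_apply]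

/-- The shifted partial derivatives of a polynomial with a leading monomial of large support span a
large space, those of a circuit of low rank a small one. -/
theorem Depth4Circuit.choose_mul_choose_le [CharZero F] (C : Depth4Circuit F N) {k d : ℕ}
    (hk : C.RankLE k) (hd : C.BottomDegLE d) {μ : Fin N →₀ ℕ} (hμ : IsLeadingExp m C.poly μ)
    {S : Finset (Fin N)} (hS : S ⊆ μ.support) (n ℓ : ℕ) :
    S.card.choose n * (N - n + ℓ).choose ℓ ≤
      (N + (ℓ + n * d)).choose (ℓ + n * d) * (C.T * (k + 1) ^ n) := by
  classical
  -- Shifts are restricted to variables off `A` so that distinct pairs give distinct leading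
  -- exponents.
  let I : Finset (Σ _ : Finset (Fin N), Fin N →₀ ℕ) :=
    (S.powersetCard n).sigma fun A => expsLE (Finset.univ \ A) ℓ
  have hI : I.card = S.card.choose n * (N - n + ℓ).choose ℓ := by
    rw [Finset.card_sigma, Finset.sum_const_nat (m := (N - n + ℓ).choose ℓ),
      Finset.card_powersetCard]
    intro A hA
    rw [card_expsLE, Finset.card_sdiff_of_subset (Finset.subset_univ _),
      (Finset.mem_powersetCard.1 hA).2, Finset.card_univ, Fintype.card_fin]
  let δ : Finset (Fin N) → (Fin N →₀ ℕ) := fun A => (A.toList.map fun s => Finsupp.single s 1).sum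
  have hδ : ∀ A s, δ A s = if s ∈ A then 1 else 0 := sum_single_apply
  have hδle : ∀ A ⊆ S, δ A ≤ μ := by
    intro A hA s
    rw [hδ]
    split_ifs with hs
    · exact Nat.one_le_iff_ne_zero.2 (Finsupp.mem_support_iff.1 (hS (hA hs)))
    · exact Nat.zero_le _
  let v : I → MvPolynomial (Fin N) F := fun i =>
    monomial i.1.2 1 * iterPderiv i.1.1.toList C.poly
  have hmem : ∀ i : I, i.1.1 ⊆ S ∧ i.1.1.card = n ∧ i.1.2.degree ≤ ℓ ∧
      ∀ s ∈ i.1.1, i.1.2 s = 0 := by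
    rintro ⟨⟨A, γ⟩, hi⟩
    rw [Finset.mem_sigma, Finset.mem_powersetCard, mem_expsLE] at hi
    refine ⟨hi.1.1, hi.1.2, hi.2.1, fun s hs => ?_⟩
    by_contra hne
    have := hi.2.2 (Finsupp.mem_support_iff.2 hne)
    simp only [Finset.mem_sdiff] at this
    exact this.2 hs
  have hlead : ∀ i : I, IsLeadingExp m (v i) (i.1.2 + (μ - δ i.1.1)) := fun i =>
    IsLeadingExp.monomial_mul (IsLeadingExp.iterPderiv _
      (by rw [tsub_add_cancel_of_le (hδle _ (hmem i).1)]; exact hμ)) _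
  have hinj : Function.Injective fun i : I => i.1.2 + (μ - δ i.1.1) := by
    intro i j hij
    obtain ⟨hi1, -, -, hi2⟩ := hmem i
    obtain ⟨hj1, -, -, hj2⟩ := hmem j
    have hs : ∀ s, i.1.2 s + (μ s - δ i.1.1 s) = j.1.2 s + (μ s - δ j.1.1 s) := fun s =>
      DFunLike.congr_fun hij s
    -- `A` is recovered as the set of places where the exponent drops below `μ`: there the shift is
    -- zero and `μ` is positive.
    have hA : i.1.1 = j.1.1 := by
      ext s
      have h1 := hs s
      have h2 := hδle _ hi1 s
      have h3 := hδle _ hj1 s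
      have h4 := hi2 s
      have h5 := hj2 s
      rw [hδ] at h2 h3
      rw [hδ, hδ] at h1
      by_cases ha : s ∈ i.1.1 <;> by_cases hb : s ∈ j.1.1 <;> simp_all <;> omega
    have hγ : i.1.2 = j.1.2 := by
      ext s
      have h1 := hs s
      rw [hA] at h1
      omega
    exact Subtype.ext (Sigma.ext hA (heq_of_eq hγ))
  obtain ⟨W, hW, hl⟩ := C.exists_polySpan_pderiv
    (K := FractionRing (MvPolynomial (Fin N) F)) hk hd n
  have := card_le_of_mem_polySpan (linearIndependent_of_isLeadingExp hinj hlead)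
    (e := ℓ + n * d) (W := W) fun i => by
      rw [map_mul]
      refine mul_mem_polySpan_of_mem ((totalDegree_monomial_le _ _).trans (hmem i).2.2.1)
        (hl _ ?_)
      rw [Finset.length_toList]
      exact (hmem i).2.1
  rw [Fintype.card_coe, hI] at this
  exact this.trans (Nat.mul_le_mul_left _ hW)

end Leading

/-! ### Binomial estimates -/

/-- Each of the `n` factors of the falling factorial is at least `n * (q - 1)`, while `n! ≤ n ^ n`.
-/
theorem pow_sub_one_le_choose (n q : ℕ) : (q - 1) ^ n ≤ (n * q).choose n := by
  refine Nat.le_of_mul_le_mul_left ?_ n.factorial_pos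
  rw [← Nat.descFactorial_eq_factorial_mul_choose]
  calc n.factorial * (q - 1) ^ n ≤ n ^ n * (q - 1) ^ n := by
        gcongr
        exact Nat.factorial_le_pow n
    _ = (n * q - n) ^ n := by rw [← mul_pow, Nat.mul_sub_one]
    _ ≤ (n * q + 1 - n) ^ n := by gcongr; omega
    _ ≤ _ := Nat.pow_sub_le_descFactorial _ _

/-- This is `(1 + 1/(d+1))^d ≤ e ≤ 3`. -/
theorem succ_pow_le_three_mul (d : ℕ) : (d + 2) ^ d ≤ 3 * (d + 1) ^ d := by
  have h1 : (1 + 1 / ((d : ℝ) + 1)) ^ d ≤ 3 := by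
    calc (1 + 1 / ((d : ℝ) + 1)) ^ d ≤ Real.exp (1 / ((d : ℝ) + 1)) ^ d := by
          gcongr
          rw [add_comm]
          exact Real.add_one_le_exp _
      _ = Real.exp (d * (1 / ((d : ℝ) + 1))) := (Real.exp_nat_mul _ _).symm
      _ ≤ Real.exp 1 := by
          gcongr
          rw [mul_one_div, div_le_one (by positivity)]
          linarith
      _ ≤ 3 := by linarith [Real.exp_one_lt_d9]
  have h2 : (1 + 1 / ((d : ℝ) + 1)) = (d + 2) / (d + 1) := by
    field_simp
    ring
  rw [h2, div_pow, div_le_iff₀ (by positivity)] at h1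
  exact_mod_cast h1

/-- With `M + 1` variables left, dropping one costs the factor `1 + N*(d+1)/(M+1)`. As `M + 1` is at
least `N/2`, this is at most `2*d + 3`. -/
theorem choose_le_pow_mul_choose_sub (N d n : ℕ) (hn : 2 * n ≤ N) :
    (N + N * (d + 1)).choose (N * (d + 1)) ≤
      (2 * d + 3) ^ n * (N - n + N * (d + 1)).choose (N * (d + 1)) := by
  induction n with
  | zero => simp
  | succ n ih =>
    refine (ih (by omega)).trans ?_
    rw [pow_succ, mul_assoc]
    refine Nat.mul_le_mul_left _ ?_
    obtain ⟨M, hM⟩ : ∃ M, N - n = M + 1 := ⟨N - n - 1, by omega⟩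
    have hM' : N - (n + 1) = M := by omega
    rw [hM, hM']
    set ℓ := N * (d + 1) with hℓ
    refine Nat.le_of_mul_le_mul_left ?_ (Nat.succ_pos M)
    have h1 : (M + 1) * (M + 1 + ℓ).choose ℓ = (M + 1 + ℓ) * (M + ℓ).choose ℓ := by
      have := Nat.add_one_mul_choose_eq (M + ℓ) M
      rw [← Nat.choose_symm_add, ← Nat.choose_symm_add (a := M), mul_comm (M + 1),
        show M + 1 + ℓ = M + ℓ + 1 by omega, this]
    rw [h1, ← mul_assoc]
    refine Nat.mul_le_mul_right _ ?_
    have : ℓ ≤ (2 * (M + 1)) * (d + 1) := Nat.mul_le_mul_right _ (by omega)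
    nlinarith

/-- Raising the degree by one costs at most the factor `1 + 1/(d+1)`, because the degree is already
at least `N*(d+1)`. -/
theorem choose_add_le (N d i : ℕ) :
    (d + 1) ^ i * (N + (N * (d + 1) + i)).choose (N * (d + 1) + i) ≤
      (d + 2) ^ i * (N + N * (d + 1)).choose (N * (d + 1)) := by
  induction i with
  | zero => simp
  | succ i ih =>
    set ℓ := N * (d + 1) with hℓ
    have h1 : (d + 1) * (N + (ℓ + i + 1)).choose (ℓ + i + 1) ≤
        (d + 2) * (N + (ℓ + i)).choose (ℓ + i) := by
      have h2 := Nat.add_one_mul_choose_eq (N + (ℓ + i)) (ℓ + i)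
      refine Nat.le_of_mul_le_mul_left ?_ (Nat.add_one_pos (ℓ + i))
      calc (ℓ + i + 1) * ((d + 1) * (N + (ℓ + i + 1)).choose (ℓ + i + 1))
          = (d + 1) * ((N + (ℓ + i) + 1).choose (ℓ + i + 1) * (ℓ + i + 1)) := by
            rw [add_assoc N (ℓ + i) 1]; ring
        _ = ((d + 1) * (N + (ℓ + i) + 1)) * (N + (ℓ + i)).choose (ℓ + i) := by rw [← h2]; ring
        _ ≤ ((ℓ + i + 1) * (d + 2)) * (N + (ℓ + i)).choose (ℓ + i) := by
            refine Nat.mul_le_mul_right _ ?_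
            nlinarith
        _ = _ := by ring
    calc _ = (d + 1) ^ i * ((d + 1) * (N + (ℓ + i + 1)).choose (ℓ + i + 1)) := by
          rw [pow_succ, mul_assoc, add_assoc ℓ]
      _ ≤ (d + 1) ^ i * ((d + 2) * (N + (ℓ + i)).choose (ℓ + i)) := by gcongr
      _ = (d + 2) * ((d + 1) ^ i * (N + (ℓ + i)).choose (ℓ + i)) := by ring
      _ ≤ (d + 2) * ((d + 2) ^ i * (N + ℓ).choose ℓ) := by gcongr
      _ = _ := by ring

theorem choose_add_mul_le (N d n : ℕ) :
    (N + (N * (d + 1) + n * d)).choose (N * (d + 1) + n * d) ≤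
      3 ^ n * (N + N * (d + 1)).choose (N * (d + 1)) := by
  refine Nat.le_of_mul_le_mul_left ?_ (show 0 < (d + 1) ^ (n * d) by positivity)
  refine (choose_add_le N d (n * d)).trans ?_
  rw [← mul_assoc]
  refine Nat.mul_le_mul_right _ ?_
  rw [mul_comm n d, pow_mul, pow_mul, ← mul_pow, mul_comm _ 3]
  exact Nat.pow_le_pow_left (succ_pow_le_three_mul d) n

/-! ### Monomials of small support and sparse nonzeros -/

/-- A nonzero polynomial computed by a depth-4 circuit with small top fan-in, small algebraic rank
and small bottom degree has a monomial of small support. -/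
theorem Depth4Circuit.exists_small_support {F : Type*} [Field F] [CharZero F] {N : ℕ}
    (C : Depth4Circuit F N) {k d : ℕ} (hk : C.RankLE k) (hd : C.BottomDegLE d) (hC : C.poly ≠ 0)
    {n : ℕ} (hn : C.T < 2 ^ n) :
    ∃ μ : Fin N →₀ ℕ, coeff μ C.poly ≠ 0 ∧
      μ.support.card ≤ n * (6 * (k + 1) * (2 * d + 3) + 1) := by
  obtain ⟨μ, hμ⟩ := exists_isLeadingExp MonomialOrder.lex hC
  refine ⟨μ, hμ.1, ?_⟩
  by_contra! hlt
  obtain ⟨S, hS, hScard⟩ := Finset.exists_subset_card_eq hlt.le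
  have hN : n * (6 * (k + 1) * (2 * d + 3) + 1) ≤ N := by
    rw [← hScard]
    simpa using S.card_le_univ
  have h2n : 2 * n ≤ N := by
    refine le_trans ?_ hN
    rw [mul_comm]
    refine Nat.mul_le_mul_left _ ?_
    nlinarith
  -- The shift degree `N*(d+1)` balances the losses: raising the degree by `n*d` costs `3^n`,
  -- dropping `n` variables costs `(2*d+3)^n`.
  have h := C.choose_mul_choose_le hk hd hμ hS n (N * (d + 1))
  rw [hScard] at h
  set X := (N - n + N * (d + 1)).choose (N * (d + 1)) with hX
  have hXpos : 0 < X := Nat.choose_pos (Nat.le_add_left _ _)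
  have h1 := pow_sub_one_le_choose n (6 * (k + 1) * (2 * d + 3) + 1)
  have h2 := (choose_add_mul_le N d n).trans
    (Nat.mul_le_mul_left _ (choose_le_pow_mul_choose_sub N d n h2n))
  rw [← hX] at h2
  -- The constant `6 = 2 * 3` pays for the loss `3^n` and leaves `2^n`, so cancelling yields `2 ^ n
  -- ≤ C.T`, contrary to `hn`.
  have h3 : (2 ^ n * (3 ^ n * (2 * d + 3) ^ n * (k + 1) ^ n)) * X ≤
      (C.T * (3 ^ n * (2 * d + 3) ^ n * (k + 1) ^ n)) * X := by
    calc _ = (6 * (k + 1) * (2 * d + 3) + 1 - 1) ^ n * X := by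
          rw [Nat.add_sub_cancel, mul_pow, mul_pow, show 6 = 2 * 3 from rfl, mul_pow]
          ring
      _ ≤ _ := Nat.mul_le_mul_right _ h1
      _ ≤ _ := h
      _ ≤ _ := Nat.mul_le_mul_right _ h2
      _ = _ := by ring
  have h4 := Nat.le_of_mul_le_mul_right (Nat.le_of_mul_le_mul_right h3 hXpos) (by positivity)
  omega

/-- A polynomial of degree at most `D` with an exponent `μ` does not vanish at all points with
entries in `{0, …, D}` supported on the support of `μ`. -/
theorem exists_eval_ne_zero_of_coeff_ne_zero {F : Type*} [Field F] [CharZero F] {N D : ℕ}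
    {P : MvPolynomial (Fin N) F} {μ : Fin N →₀ ℕ} (hμ : coeff μ P ≠ 0) (hD : P.totalDegree ≤ D) :
    ∃ x : Fin N → ℕ, (∀ i, x i ≤ D) ∧ (∀ i ∉ μ.support, x i = 0) ∧
      eval (fun i => (x i : F)) P ≠ 0 := by
  classical
  -- `P'` is `P` with the variables outside the support of `μ` set to zero; it still contains `μ`.
  let P' : MvPolynomial (Fin N) F :=
    ∑ ν ∈ P.support.filter (fun ν => ν.support ⊆ μ.support), monomial ν (coeff ν P)
  have hcoeff : ∀ ν, coeff ν P' = if ν.support ⊆ μ.support then coeff ν P else 0 := by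
    intro ν
    simp only [P', coeff_sum, coeff_monomial, Finset.sum_ite_eq', Finset.mem_filter, mem_support_iff]
    by_cases h1 : coeff ν P = 0 <;> simp [h1]
  have hP' : P' ≠ 0 := by
    intro h
    have := hcoeff μ
    rw [h, coeff_zero, if_pos subset_rfl] at this
    exact hμ this.symm
  -- The grid for the Combinatorial Nullstellensatz: a single point suffices in directions where
  -- `P'` has degree zero.
  let S : Fin N → Finset F := fun i =>
    if i ∈ μ.support then (Finset.range (D + 1)).image (fun n : ℕ => (n : F)) else {0}
  by_contra! hcon
  refine hP' (eq_zero_of_eval_zero_at_prod_finset P' S (fun i => ?_) fun y hy => ?_)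
  · rw [degreeOf_lt_iff]
    · intro ν hν
      rw [mem_support_iff, hcoeff] at hν
      split_ifs at hν with h
      · simp only [S]
        split_ifs with hi
        · rw [Finset.card_image_of_injective _ Nat.cast_injective, Finset.card_range]
          refine Nat.lt_succ_of_le (le_trans ?_ ((le_totalDegree (mem_support_iff.2 hν)).trans hD))
          exact Finsupp.le_degree i ν
        · rw [Finsupp.notMem_support_iff.1 fun h' => hi (h h')]
          simp
      · exact absurd rfl hν
    · simp only [S]
      split_ifs <;> simp
  · have hnat : ∀ i, ∃ n : ℕ, n ≤ D ∧ (i ∉ μ.support → n = 0) ∧ (n : F) = y i := by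
      intro i
      have := hy i
      simp only [S] at this
      split_ifs at this with hi
      · obtain ⟨n, hn, hni⟩ := Finset.mem_image.1 this
        exact ⟨n, Nat.lt_succ_iff.1 (Finset.mem_range.1 hn), fun h => absurd hi h, hni⟩
      · exact ⟨0, Nat.zero_le _, fun _ => rfl, by simpa using (Finset.mem_singleton.1 this).symm⟩
    choose x hx hx0 hxy using hnat
    have h := hcon x hx hx0
    rw [← funext hxy]
    rw [eval_eq] at h
    simp only [P', map_sum, eval_monomial]
    rw [← h, Finset.sum_filter]
    refine Finset.sum_congr rfl fun ν hν => ?_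
    split_ifs with hs
    · rfl
    · obtain ⟨i, hi, hi'⟩ := Finset.not_subset.1 hs
      rw [Finset.prod_eq_zero hi, mul_zero]
      rw [hx0 i hi', Nat.cast_zero, zero_pow (Finsupp.mem_support_iff.1 hi)]

/-- Polynomials computed by small circuits of low rank are hit by sparse points. -/
theorem exists_sparse_point {F : Type*} [Field F] [CharZero F] {N k d s D n : ℕ}
    {P : MvPolynomial (Fin N) F} (hP : P ∈ sigmaPiSigmaPi F N k d s) (hD : P.totalDegree ≤ D)
    (h0 : P ≠ 0) (hs : s < 2 ^ n) :
    ∃ x : Fin N → ℕ, (∀ i, x i ≤ D) ∧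
      (Finset.univ.filter fun i => x i ≠ 0).card ≤ n * (6 * (k + 1) * (2 * d + 3) + 1) ∧
      eval (fun i => (x i : F)) P ≠ 0 := by
  obtain ⟨C, hk, hd, hsize, rfl⟩ := hP
  obtain ⟨μ, hμ, hcard⟩ := C.exists_small_support hk hd h0
    (((le_max_left _ _).trans hsize).trans_lt hs)
  obtain ⟨x, hx, hx0, hxP⟩ := exists_eval_ne_zero_of_coeff_ne_zero hμ hD
  refine ⟨x, hx, (Finset.card_le_card fun i hi => ?_).trans hcard, hxP⟩
  by_contra h
  exact (Finset.mem_filter.1 hi).2 (hx0 i h)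

/-! ### Words for points and their enumeration -/

namespace SparseEnum

/-- Clear all bits of a word. -/
def clearBit : Γ' → Γ'
  | Γ'.bit _ => Γ'.bit false
  | x => x

/-- The words obtained from `w` by setting at most `u` of its bits to `true` and the other ones to
`false`, in lexicographic order. -/
def variants : ℕ → List Γ' → List (List Γ')
  | _, [] => [[]]
  | 0, Γ'.bit _ :: w => (variants 0 w).map (Γ'.bit false :: ·)
  | u + 1, Γ'.bit _ :: w => (variants (u + 1) w).map (Γ'.bit false :: ·) ++
      (variants u w).map (Γ'.bit true :: ·)
  | u, x :: w => (variants u w).map (x :: ·)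

theorem mem_variants {s : List Γ'} {u : ℕ} (hs : s.count (Γ'.bit true) ≤ u) :
    s ∈ variants u (s.map clearBit) := by
  induction s generalizing u with
  | nil => cases u <;> simp [variants]
  | cons x s ih =>
    rcases x with _ | (_ | _) | _ | _ | _
    all_goals cases u <;> simp_all [variants, clearBit]

theorem map_clearBit_of_mem_variants {s w : List Γ'} {u : ℕ} (hs : s ∈ variants u w) :
    s.map clearBit = w.map clearBit := by
  induction w generalizing s u with
  | nil => cases u <;> simp_all [variants]
  | cons x w ih =>
    rcases x with _ | b | _ | _ | _ <;> cases u <;> simp [variants] at hs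
    case bit.succ =>
      rcases hs with ⟨t, ht, rfl⟩ | ⟨t, ht, rfl⟩ <;> simp [ih ht, clearBit]
    all_goals
      obtain ⟨t, ht, rfl⟩ := hs
      simp [ih ht, clearBit]

theorem length_variants_pos (u : ℕ) (w : List Γ') : 0 < (variants u w).length := by
  induction w generalizing u with
  | nil => cases u <;> simp [variants]
  | cons x w ih =>
    rcases x with _ | b | _ | _ | _ <;> cases u <;> simp [variants, ih]

/-- The counts obey a Pascal recursion, and `(r+1)^(u+1) + (r+1)^u = (r+1)^u * (r+2)`. -/
theorem length_variants_le (u : ℕ) (w : List Γ') :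
    (variants u w).length ≤ (w.length + 1) ^ u := by
  induction w generalizing u with
  | nil => cases u <;> simp [variants]
  | cons x w ih =>
    have hmono : ∀ u, (variants u w).length ≤ (w.length + 1 + 1) ^ u := fun u =>
      (ih u).trans (Nat.pow_le_pow_left (Nat.le_succ _) u)
    rcases x with _ | b | _ | _ | _ <;> cases u <;> simp [variants]
    case bit.succ u =>
      calc _ ≤ (w.length + 1) ^ (u + 1) + (w.length + 1) ^ u := add_le_add (ih _) (ih _)
        _ = (w.length + 1) ^ u * (w.length + 1 + 1) := by ring
        _ ≤ (w.length + 1 + 1) ^ u * (w.length + 1 + 1) := by gcongr; omega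
        _ = _ := (pow_succ _ _).symm
    all_goals exact (hmono _).trans (by simp)

/-- Read off the coordinates of a point: each `comma` starts a new coordinate, whose binary digits
follow, the most significant one first. The last coordinate of the point is read first. -/
def decode : List Γ' → List ℕ → List ℕ
  | [], c => c
  | Γ'.comma :: w, c => decode w (0 :: c)
  | Γ'.bit b :: w, x :: c => decode w ((2 * x + b.toNat) :: c)
  | _ :: w, c => decode w c

/-- The word written on top of `out` when reading a word. -/
def emit : Bool → List Γ' → List Γ' → List Γ'
  | _, [], out => out
  | f, Γ'.bit b :: w, out => emit (f || b) w (if f || b then Γ'.bit b :: out else out)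
  | _, _ :: w, out => emit false w (Γ'.comma :: out)

/-- `encodeNat` is least significant digit first. The excluded case is zero, whose code is empty. -/
theorem encodeNat_bit (n : ℕ) (b : Bool) (h : n ≠ 0 ∨ b = true) :
    encodeNat (2 * n + b.toNat) = b :: encodeNat n := by
  have key : ∀ m : Num, (m ≠ 0 ∨ b = true) →
      encodeNum (cond b m.bit1 m.bit0) = b :: encodeNum m := by
    intro m hm
    cases m <;> cases b <;> simp_all [Num.bit0, Num.bit1, encodeNum, encodePosNum]
    all_goals first | rfl | exact absurd rfl hm
  have hcast : ((2 * n + b.toNat : ℕ) : Num) = cond b (n : Num).bit1 (n : Num).bit0 := by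
    cases b
    · simp [Num.bit0_of_bit0, two_mul]
    · simp [Num.bit1_of_bit1, two_mul]
  rw [encodeNat, hcast, key]
  · rfl
  · refine h.imp_left fun h0 hm => h0 ?_
    have := congrArg (fun m : Num => (m : ℕ)) hm
    simpa using this

/-- Words over bits and commas. -/
def IsWord (w : List Γ') : Prop := ∀ x ∈ w, x = Γ'.comma ∨ ∃ b, x = Γ'.bit b

/-- Pushing digits most significant first leaves them on the stack in the order of `encodeNat`. The
flag records whether the current coordinate is already nonzero, so that leading zeros are
suppressed. -/
theorem emit_eq {w : List Γ'} (hw : IsWord w) (x : ℕ) (c : List ℕ) (out : List Γ') :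
    emit (decide (x ≠ 0)) w ((x :: c).flatMap encodeCoord ++ out) =
      (decode w (x :: c)).flatMap encodeCoord ++ out := by
  induction w generalizing x c with
  | nil => rfl
  | cons y w ih =>
    have hw' : IsWord w := fun z hz => hw z (List.mem_cons_of_mem _ hz)
    rcases hw y List.mem_cons_self with rfl | ⟨b, rfl⟩
    · have := ih hw' 0 (x :: c)
      simpa [emit, decode, encodeCoord, encodeNat, encodeNum] using this
    · have := ih hw' (2 * x + b.toNat) c
      rw [decode, ← this, emit]
      by_cases h : x ≠ 0 ∨ b = true
      · have h1 : (decide (x ≠ 0) || b) = true := by simpa using h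
        have h2 : 2 * x + b.toNat ≠ 0 := by
          rcases h with h | rfl
          · omega
          · simp
        simp only [h1, h2, if_true, ne_eq, not_false_eq_true, decide_true]
        simp [encodeCoord, encodeNat_bit x b h]
      · push Not at h
        obtain ⟨rfl, hb⟩ := h
        have hb : b = false := by simpa using hb
        subst hb
        simp

theorem length_decode (w : List Γ') (c : List ℕ) :
    (decode w c).length = w.count Γ'.comma + c.length := by
  induction w generalizing c with
  | nil => simp [decode]
  | cons x w ih =>
    rcases x with _ | b | _ | _ | _ <;> cases c <;> (simp [decode, ih]; try omega)

theorem decode_append (v w : List Γ') (c : List ℕ) :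
    decode (v ++ w) c = decode w (decode v c) := by
  induction v generalizing c with
  | nil => rfl
  | cons x v ih =>
    rcases x with _ | b | _ | _ | _ <;> cases c <;> simp [decode, ih]

/-- The `L` low binary digits of a number, the most significant one first. -/
def digits : ℕ → ℕ → List Γ'
  | 0, _ => []
  | L + 1, x => digits L (x / 2) ++ [Γ'.bit (decide (x % 2 = 1))]

theorem decode_digits {L x : ℕ} (hx : x < 2 ^ L) (c : List ℕ) :
    decode (digits L x) (0 :: c) = x :: c := by
  induction L generalizing x with
  | zero =>
    have : x = 0 := by simpa using hx
    subst this
    rfl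
  | succ L ih =>
    rw [digits, decode_append, ih (by rw [pow_succ] at hx; omega)]
    rcases Nat.mod_two_eq_zero_or_one x with h | h <;> simp [decode, h] <;> omega

theorem map_clearBit_digits (L x : ℕ) :
    (digits L x).map clearBit = List.replicate L (Γ'.bit false) := by
  induction L generalizing x with
  | zero => rfl
  | succ L ih => rw [digits, List.map_append, ih, List.replicate_succ']; rfl

theorem digits_zero (L : ℕ) : digits L 0 = List.replicate L (Γ'.bit false) := by
  induction L with
  | zero => rfl
  | succ L ih => rw [digits, Nat.zero_div, ih, List.replicate_succ']; rfl

theorem count_digits_le (L x : ℕ) :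
    (digits L x).count (Γ'.bit true) ≤ if x ≠ 0 then L else 0 := by
  split_ifs with h
  · have : (digits L x).length = L := by
      rw [← List.length_map (f := clearBit), map_clearBit_digits, List.length_replicate]
    exact List.count_le_length.trans this.le
  · push Not at h
    subst h
    rw [digits_zero, List.count_replicate]
    simp

/-- The word of the origin of `ℕ ^ N`, with `L` digits for each coordinate. -/
def template (L : ℕ) : ℕ → List Γ'
  | 0 => []
  | N + 1 => Γ'.comma :: (List.replicate L (Γ'.bit false) ++ template L N)

theorem length_template (L N : ℕ) : (template L N).length = N * (L + 1) := by
  induction N with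
  | zero => simp [template]
  | succ N ih => simp [template, ih]; ring

/-- The word of a point. -/
def word (L : ℕ) : List ℕ → List Γ'
  | [] => []
  | x :: l => word L l ++ (Γ'.comma :: digits L x)

theorem template_succ' (L N : ℕ) : template L (N + 1) =
    template L N ++ (Γ'.comma :: List.replicate L (Γ'.bit false)) := by
  induction N with
  | zero => simp [template]
  | succ N ih =>
    change Γ'.comma :: (_ ++ template L (N + 1)) = (Γ'.comma :: (_ ++ template L N)) ++ _
    rw [ih]
    simp

theorem map_clearBit_word (L : ℕ) (l : List ℕ) :
    (word L l).map clearBit = template L l.length := by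
  induction l with
  | nil => rfl
  | cons x l ih => simp [word, ih, template_succ', map_clearBit_digits, clearBit]

/-- The word lists the last coordinate first because `decode` prepends the coordinates it reads. -/
theorem decode_word {L : ℕ} {l : List ℕ} (hl : ∀ x ∈ l, x < 2 ^ L) : decode (word L l) [] = l := by
  induction l with
  | nil => rfl
  | cons x l ih =>
    rw [word, decode_append, ih fun y hy => hl y (List.mem_cons_of_mem _ hy), decode]
    exact decode_digits (hl x List.mem_cons_self) l

/-- Only nonzero coordinates contribute ones, at most `L` each; sparsity of the point becomes
sparsity of the word. -/
theorem count_word_le (L : ℕ) (l : List ℕ) :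
    (word L l).count (Γ'.bit true) ≤ (l.countP fun x => x ≠ 0) * L := by
  induction l with
  | nil => simp [word]
  | cons x l ih =>
    have := count_digits_le L x
    rw [word, List.count_append, List.count_cons, List.countP_cons]
    simp only [beq_iff_eq, reduceCtorEq, if_false, decide_eq_true_eq]
    split_ifs at this ⊢ <;> nlinarith

/-! ### The Turing machine -/

open Turing Turing.TM2.Stmt

/-- The stacks of the machine. -/
inductive Stack
  | inp | cnt | half | half' | log | log' | reg (i : Fin 5) | front | back | out
  deriving DecidableEq, Fintype

/-- The stack alphabets. -/
@[reducible] def Alphabet : Stack → Type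
  | Stack.inp => Bool
  | _ => Γ'

/-- The labels of the machine. -/
inductive Label
  | copy | round | halve | unhalve (more : Bool)
  | mulOuter (i : Fin 4) | mulInner (i : Fin 4) | mulRestore (i : Fin 4)
  | buildOuter | buildInner | buildRestore
  | start | read (started : Bool) | rewind (carry : Bool) | clean
  deriving Fintype

/-- Statements of the machine; its internal state is the last symbol popped. -/
abbrev MStmt := TM2.Stmt Alphabet Label (Option Γ')

/-- Push `c` unit symbols on the stack `log`. -/
def pushLog : ℕ → MStmt → MStmt
  | 0, q => q
  | c + 1, q => push Stack.log (fun _ => Γ'.blank) (pushLog c q)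

/-- Pop a stack and branch on whether it was nonempty. -/
def popCase (k : Stack) (f : Alphabet k → Γ') (q₁ q₂ : MStmt) : MStmt :=
  pop k (fun _ x => x.map f) (branch Option.isSome q₁ q₂)

/-- The label after the multiplication with index `i`. -/
def nextLabel (i : Fin 4) : Label :=
  if h : i.val + 1 < 4 then Label.mulOuter ⟨i.val + 1, h⟩ else Label.buildOuter

/-- The program. -/
def program (c : ℕ) : Label → MStmt
  | Label.copy => popCase Stack.inp Γ'.bit
      (push Stack.cnt (fun _ => Γ'.blank) <| push Stack.half (fun _ => Γ'.blank) <|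
        goto fun _ => Label.copy)
      (push (Stack.reg 0) (fun _ => Γ'.blank) <| goto fun _ => Label.round)
  | Label.round => pushLog c (goto fun _ => Label.halve)
  | Label.halve => popCase Stack.half id
      (popCase Stack.half id
        (push Stack.half' (fun _ => Γ'.blank) <| goto fun _ => Label.halve)
        (goto fun _ => Label.unhalve false))
      (goto fun _ => Label.unhalve false)
  | Label.unhalve more => popCase Stack.half' id
      (push Stack.half (fun _ => Γ'.blank) <| goto fun _ => Label.unhalve true)
      (goto fun _ => if more then Label.round else Label.mulOuter 0)
  | Label.mulOuter i => popCase (Stack.reg i.castSucc) id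
      (goto fun _ => Label.mulInner i) (goto fun _ => nextLabel i)
  | Label.mulInner i => popCase Stack.log id
      (push Stack.log' (fun _ => Γ'.blank) <| push (Stack.reg i.succ) (fun _ => Γ'.blank) <|
        goto fun _ => Label.mulInner i)
      (goto fun _ => Label.mulRestore i)
  | Label.mulRestore i => popCase Stack.log' id
      (push Stack.log (fun _ => Γ'.blank) <| goto fun _ => Label.mulRestore i)
      (goto fun _ => Label.mulOuter i)
  | Label.buildOuter => popCase Stack.cnt id
      (goto fun _ => Label.buildInner) (goto fun _ => Label.start)
  | Label.buildInner => popCase Stack.log id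
      (push Stack.log' (fun _ => Γ'.blank) <| push Stack.front (fun _ => Γ'.bit false) <|
        goto fun _ => Label.buildInner)
      (push Stack.front (fun _ => Γ'.comma) <| goto fun _ => Label.buildRestore)
  | Label.buildRestore => popCase Stack.log' id
      (push Stack.log (fun _ => Γ'.blank) <| goto fun _ => Label.buildRestore)
      (goto fun _ => Label.buildOuter)
  | Label.start => push Stack.out (fun _ => Γ'.ket) <| goto fun _ => Label.read false
  | Label.read f => popCase Stack.front id
      (push Stack.back (fun x => x.getD Γ'.blank) <|
        branch (fun x => x = some Γ'.comma)
          (push Stack.out (fun _ => Γ'.comma) <| goto fun _ => Label.read false)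
          (branch (fun x => f || x = some (Γ'.bit true))
            (push Stack.out (fun x => x.getD Γ'.blank) <| goto fun _ => Label.read true)
            (goto fun _ => Label.read false)))
      (goto fun _ => Label.rewind true)
  -- Backtracking from the right end: ones are cleared and refunded to the budget `reg 4`. The first
  -- zero met while budget remains is set to one, after which the next word starts; if there is
  -- none, the enumeration is over.
  | Label.rewind true => popCase Stack.back id
      (branch (fun x => x = some Γ'.comma)
        (push Stack.front (fun _ => Γ'.comma) <| goto fun _ => Label.rewind true)
        (branch (fun x => x = some (Γ'.bit true))
          (push Stack.front (fun _ => Γ'.bit false) <|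
            push (Stack.reg 4) (fun _ => Γ'.blank) <| goto fun _ => Label.rewind true)
          (popCase (Stack.reg 4) id
            (push Stack.front (fun _ => Γ'.bit true) <| goto fun _ => Label.rewind false)
            (push Stack.front (fun _ => Γ'.bit false) <| goto fun _ => Label.rewind true))))
      (goto fun _ => Label.clean)
  | Label.rewind false => popCase Stack.back id
      (push Stack.front (fun x => x.getD Γ'.blank) <| goto fun _ => Label.rewind false)
      (goto fun _ => Label.start)
  | Label.clean => popCase Stack.front id (goto fun _ => Label.clean) <|
      popCase (Stack.reg 4) id (goto fun _ => Label.clean) <|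
      popCase Stack.log id (goto fun _ => Label.clean) <|
      load (fun _ => none) halt

/-! ### Correctness of the setup phase -/

/-- The contents of the stacks; those that hold unit symbols only are given by their heights. -/
structure Store where
  inp : List Bool := []
  cnt : ℕ := 0
  half : ℕ := 0
  half' : ℕ := 0
  log : ℕ := 0
  log' : ℕ := 0
  reg : Fin 5 → ℕ := 0
  front : List Γ' := []
  back : List Γ' := []
  out : List Γ' := []

/-- The stacks described by a store. -/
def Store.stk (s : Store) : ∀ k, List (Alphabet k)
  | Stack.inp => s.inp
  | Stack.cnt => List.replicate s.cnt Γ'.blank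
  | Stack.half => List.replicate s.half Γ'.blank
  | Stack.half' => List.replicate s.half' Γ'.blank
  | Stack.log => List.replicate s.log Γ'.blank
  | Stack.log' => List.replicate s.log' Γ'.blank
  | Stack.reg i => List.replicate (s.reg i) Γ'.blank
  | Stack.front => s.front
  | Stack.back => s.back
  | Stack.out => s.out

/-- Whatever the internal state, the machine gets from one label and store to another one within
`t` steps. -/
def Run (c t : ℕ) (l : Label) (s : Store) (l' : Label) (s' : Store) : Prop :=
  ∀ v, ∃ v', ∃ n ≤ t, (flip bind (TM2.step (program c)))^[n] (some ⟨some l, v, s.stk⟩) =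
    some ⟨some l', v', s'.stk⟩

theorem Run.refl (c : ℕ) (l : Label) (s : Store) : Run c 0 l s l s :=
  fun v => ⟨v, 0, le_rfl, rfl⟩

theorem Run.trans {c t₁ t₂ : ℕ} {l₁ l₂ l₃ : Label} {s₁ s₂ s₃ : Store} (h₁ : Run c t₁ l₁ s₁ l₂ s₂)
    (h₂ : Run c t₂ l₂ s₂ l₃ s₃) : Run c (t₁ + t₂) l₁ s₁ l₃ s₃ := by
  intro v
  obtain ⟨v₂, n₁, hn₁, h₁⟩ := h₁ v
  obtain ⟨v₃, n₂, hn₂, h₂⟩ := h₂ v₂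
  refine ⟨v₃, n₂ + n₁, by omega, ?_⟩
  rw [Function.iterate_add_apply, h₁, h₂]

theorem Run.mono {c t₁ t₂ : ℕ} {l₁ l₂ : Label} {s₁ s₂ : Store} (h₁ : Run c t₁ l₁ s₁ l₂ s₂)
    (h : t₁ ≤ t₂) : Run c t₂ l₁ s₁ l₂ s₂ := fun v => by
  obtain ⟨v₂, n₁, hn₁, h₁⟩ := h₁ v
  exact ⟨v₂, n₁, hn₁.trans h, h₁⟩

theorem Run.of_step {c : ℕ} {l l' : Label} {s s' : Store}
    (h : ∀ v, ∃ v' S, TM2.stepAux (program c l) v s.stk = ⟨some l', v', S⟩ ∧ S = s'.stk) :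
    Run c 1 l s l' s' := fun v => by
  obtain ⟨v', S, h, rfl⟩ := h v
  exact ⟨v', 1, le_rfl, congrArg some h⟩

theorem run_copy (c n m : ℕ) (s : Store) :
    Run c (n + 1) Label.copy
      { s with inp := List.replicate n true, cnt := m, half := m, reg := 0 } Label.round
      { s with inp := [], cnt := m + n, half := m + n, reg := Function.update 0 0 1 } := by
  induction n generalizing m with
  | zero =>
    refine Run.of_step fun v => ⟨_, _, rfl, ?_⟩
    funext k
    cases k <;> try rfl
    rename_i i
    fin_cases i <;> rfl
  | succ n ih =>
    have h : Run c 1 Label.copy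
      { s with inp := List.replicate (n + 1) true, cnt := m, half := m, reg := 0 } Label.copy
      { s with inp := List.replicate n true, cnt := m + 1, half := m + 1, reg := 0 } := by
      refine Run.of_step fun v => ⟨_, _, rfl, ?_⟩
      funext k
      cases k <;> rfl
    have := h.trans (ih (m + 1))
    rw [show m + (n + 1) = m + 1 + n by omega]
    exact this.mono (by omega)

theorem stepAux_pushLog (c : ℕ) (q : MStmt) (v : Option Γ') (s : Store) :
    TM2.stepAux (pushLog c q) v s.stk = TM2.stepAux q v { s with log := s.log + c }.stk := by
  induction c generalizing s with
  | zero => rfl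
  | succ c ih =>
    have : Function.update s.stk Stack.log (Γ'.blank :: s.stk Stack.log) =
        { s with log := s.log + 1 }.stk := by
      funext k
      cases k <;> rfl
    rw [pushLog, TM2.stepAux, this, ih]
    congr 3
    exact Nat.add_right_comm _ _ _

theorem run_round (c : ℕ) (s : Store) :
    Run c 1 Label.round s Label.halve { s with log := s.log + c } :=
  Run.of_step fun v => ⟨_, _, by rw [program, stepAux_pushLog]; rfl, rfl⟩

theorem run_halve (c n m : ℕ) (s : Store) :
    Run c (n + 1) Label.halve { s with half := n, half' := m } (Label.unhalve false)
      { s with half := 0, half' := m + n / 2 } := by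
  induction n using Nat.strong_induction_on generalizing m with
  | _ n ih =>
    rcases n with _ | _ | n
    · refine Run.of_step fun v => ⟨_, _, rfl, ?_⟩
      funext k
      cases k <;> rfl
    · refine Run.mono (t₁ := 1) (Run.of_step fun v => ⟨_, _, rfl, ?_⟩) (by omega)
      funext k
      cases k <;> rfl
    · have h : Run c 1 Label.halve { s with half := n + 2, half' := m } Label.halve
          { s with half := n, half' := m + 1 } := by
        refine Run.of_step fun v => ⟨_, _, rfl, ?_⟩
        funext k
        cases k <;> rfl
      have := h.trans (ih n (by omega) (m + 1))
      rw [show m + (n + 1 + 1) / 2 = m + 1 + n / 2 by omega]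
      exact this.mono (by omega)

theorem run_unhalve (c n m : ℕ) (b : Bool) (s : Store) :
    Run c (n + 1) (Label.unhalve b) { s with half := m, half' := n }
      (if b = true ∨ n ≠ 0 then Label.round else Label.mulOuter 0)
      { s with half := m + n, half' := 0 } := by
  induction n generalizing m b with
  | zero =>
    refine Run.of_step fun v => ⟨none, { s with half := m, half' := 0 }.stk, ?_, rfl⟩
    have : Function.update { s with half := m, half' := 0 }.stk Stack.half' [] =
        { s with half := m, half' := 0 }.stk := by
      funext k
      cases k <;> rfl
    change TM2.Cfg.mk _ _ (Function.update { s with half := m, half' := 0 }.stk Stack.half' []) = _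
    rw [this]
    cases b <;> simp <;> rfl
  | succ n ih =>
    have h : Run c 1 (Label.unhalve b) { s with half := m, half' := n + 1 } (Label.unhalve true)
        { s with half := m + 1, half' := n } := by
      refine Run.of_step fun v => ⟨_, _, rfl, ?_⟩
      funext k
      cases k <;> rfl
    have := h.trans (ih (m + 1) true)
    rw [show m + (n + 1) = m + 1 + n by omega]
    simp only [true_or, if_true] at this
    simp only [ne_eq, Nat.succ_ne_zero, not_false_eq_true, or_true, if_true]
    exact this.mono (by omega)

/-- Each round adds `c` symbols to `log` and halves the counter, which vanishes after `Nat.log 2 n +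
1` rounds, also for `n = 0`. -/
theorem run_rounds (c n : ℕ) (s : Store) :
    Run c ((Nat.log 2 n + 1) * (2 * n + 3)) Label.round { s with half := n, half' := 0 }
      (Label.mulOuter 0)
      { s with half := 0, half' := 0, log := s.log + c * (Nat.log 2 n + 1) } := by
  induction n using Nat.strong_induction_on generalizing s with
  | _ n ih =>
    have h1 := ((run_round c { s with half := n, half' := 0 }).trans
      (run_halve c n 0 { s with log := s.log + c })).trans
      (run_unhalve c (0 + n / 2) 0 false { s with log := s.log + c })
    rcases lt_or_ge n 2 with hn | hn
    · have h0 : n / 2 = 0 := by omega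
      have hl : Nat.log 2 n = 0 := Nat.log_of_lt hn
      simp only [h0, hl] at h1 ⊢
      simp only [Nat.zero_add, Nat.mul_one, ne_eq, not_true_eq_false, or_false, Bool.false_eq_true,
        if_false, Nat.add_zero, Nat.one_mul] at h1 ⊢
      exact h1.mono (by omega)
    · have h0 : n / 2 ≠ 0 := by omega
      have hl : Nat.log 2 n = Nat.log 2 (n / 2) + 1 := by
        rw [Nat.log_div_base]
        have := Nat.log_pos one_lt_two hn
        omega
      simp only [Nat.zero_add, ne_eq, h0, not_false_eq_true, or_true, if_true] at h1
      have := h1.trans (ih (n / 2) (by omega) { s with log := s.log + c })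
      rw [hl]
      have he : s.log + c * (Nat.log 2 (n / 2) + 1 + 1) =
        s.log + c + c * (Nat.log 2 (n / 2) + 1) := by ring
      rw [he]
      refine this.mono ?_
      have h4 : (Nat.log 2 (n / 2) + 1) * (2 * (n / 2) + 3) ≤
        (Nat.log 2 (n / 2) + 1) * (2 * n + 3) := Nat.mul_le_mul_left _ (by omega)
      rw [add_mul _ 1 (2 * n + 3)]
      omega

theorem run_mulInner (c : ℕ) (i : Fin 4) (n m a : ℕ) (s : Store) (r : Fin 5 → ℕ) :
    Run c (n + 1) (Label.mulInner i)
      { s with log := n, log' := m, reg := Function.update r i.succ a } (Label.mulRestore i)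
      { s with log := 0, log' := m + n, reg := Function.update r i.succ (a + n) } := by
  induction n generalizing m a with
  | zero =>
    refine Run.of_step fun v => ⟨_, _, rfl, ?_⟩
    funext k
    cases k <;> rfl
  | succ n ih =>
    have h : Run c 1 (Label.mulInner i)
        { s with log := n + 1, log' := m, reg := Function.update r i.succ a } (Label.mulInner i)
        { s with log := n, log' := m + 1, reg := Function.update r i.succ (a + 1) } := by
      refine Run.of_step fun v => ⟨_, _, rfl, ?_⟩
      funext k
      cases k <;> try rfl
      rename_i j
      by_cases hj : j = i.succ
      · subst hj
        simp [Store.stk, List.replicate_succ]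
      · simp [Store.stk, hj]
    have := h.trans (ih (m + 1) (a + 1))
    rw [show m + (n + 1) = m + 1 + n by omega, show a + (n + 1) = a + 1 + n by omega]
    exact this.mono (by omega)

theorem run_mulRestore (c : ℕ) (i : Fin 4) (n m : ℕ) (s : Store) :
    Run c (n + 1) (Label.mulRestore i) { s with log := m, log' := n } (Label.mulOuter i)
      { s with log := m + n, log' := 0 } := by
  induction n generalizing m with
  | zero =>
    refine Run.of_step fun v => ⟨_, _, rfl, ?_⟩
    funext k
    cases k <;> rfl
  | succ n ih =>
    have h : Run c 1 (Label.mulRestore i) { s with log := m, log' := n + 1 } (Label.mulRestore i)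
        { s with log := m + 1, log' := n } := by
      refine Run.of_step fun v => ⟨_, _, rfl, ?_⟩
      funext k
      cases k <;> rfl
    have := h.trans (ih (m + 1))
    rw [show m + (n + 1) = m + 1 + n by omega]
    exact this.mono (by omega)


/-- Each unit of the source register adds the height of `log` to the next one; `log'` holds the
symbols of `log` until they are restored. -/
theorem run_mulOuter (c : ℕ) (i : Fin 4) (a b y : ℕ) (s : Store) :
    Run c (a * (2 * b + 3) + 1) (Label.mulOuter i)
      { s with log := b, log' := 0, reg := Function.update (Function.update (0 : Fin 5 → ℕ) i.castSucc a) i.succ y }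
      (nextLabel i)
      { s with log := b, log' := 0, reg := Function.update (0 : Fin 5 → ℕ) i.succ (y + a * b) } := by
  have hne : i.castSucc ≠ i.succ := by
    simp [Fin.ext_iff]
  induction a generalizing y with
  | zero =>
    refine Run.mono (t₁ := 1) (Run.of_step fun v => ⟨none,
      { s with log := b, log' := 0, reg := Function.update (0 : Fin 5 → ℕ) i.succ (y + 0 * b) }.stk, ?_, rfl⟩)
      (by omega)
    have h0 : Function.update (Function.update (0 : Fin 5 → ℕ) i.castSucc 0) i.succ y =
        Function.update (0 : Fin 5 → ℕ) i.succ (y + 0 * b) := by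
      rw [Nat.zero_mul, Nat.add_zero]
      congr 1
      exact Function.update_eq_self _ _
    rw [h0]
    set t : Store := { s with log := b, log' := 0, reg := Function.update (0 : Fin 5 → ℕ) i.succ (y + 0 * b) }
    have h1 : t.stk (Stack.reg i.castSucc) = [] := by simp [t, Store.stk, hne]
    have h2 : Function.update t.stk (Stack.reg i.castSucc) [] = t.stk := by
      rw [← h1]
      exact Function.update_eq_self _ _
    simp only [program, popCase, TM2.stepAux, h1, List.head?_nil, List.tail_nil, h2]
    rfl
  | succ a ih =>
    have h : Run c 1 (Label.mulOuter i)
        { s with log := b, log' := 0, reg := Function.update (Function.update (0 : Fin 5 → ℕ) i.castSucc (a + 1)) i.succ y }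
        (Label.mulInner i)
        { s with log := b, log' := 0, reg := Function.update (Function.update (0 : Fin 5 → ℕ) i.castSucc a) i.succ y } := by
      refine Run.of_step fun v => ⟨some Γ'.blank, _, ?_, rfl⟩
      set t : Store := { s with log := b, log' := 0, reg := Function.update (Function.update (0 : Fin 5 → ℕ) i.castSucc (a + 1)) i.succ y }
      have h1 : t.stk (Stack.reg i.castSucc) = Γ'.blank :: List.replicate a Γ'.blank := by
        simp [t, Store.stk, hne, List.replicate_succ]
      simp only [program, popCase, TM2.stepAux, h1, List.head?_cons, List.tail_cons, Option.map_some,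
        Option.isSome_some, cond_true, id]
      congr 1
      funext k
      cases k <;> try rfl
      rename_i j
      by_cases hj : j = i.succ
      · subst hj
        simp [Store.stk, t, hne.symm]
      · by_cases hj' : j = i.castSucc
        · subst hj'
          simp [Store.stk, hne]
        · simp [Store.stk, t, hj, hj']
    have := ((h.trans (run_mulInner c i b 0 y s _)).trans
      (run_mulRestore c i (0 + b) 0
        { s with reg := Function.update (Function.update (0 : Fin 5 → ℕ) i.castSucc a) i.succ (y + b) })).trans
      (by simpa only [Nat.zero_add] using ih (y + b))
    rw [show y + (a + 1) * b = y + b + a * b by ring]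
    refine this.mono ?_
    rw [add_mul]
    omega

/-- Four multiplications by `b`, starting from one, leave the budget of ones in `reg 4`. -/
theorem run_muls (c b : ℕ) (s : Store) :
    Run c ((b ^ 3 + b ^ 2 + b + 1) * (2 * b + 3) + 4) (Label.mulOuter 0)
      { s with log := b, log' := 0, reg := Function.update 0 0 1 } Label.buildOuter
      { s with log := b, log' := 0, reg := Function.update 0 4 (b ^ 4) } := by
  have key : ∀ i : Fin 4, ∀ a, Run c (a * (2 * b + 3) + 1) (Label.mulOuter i)
      { s with log := b, log' := 0, reg := Function.update (0 : Fin 5 → ℕ) i.castSucc a } (nextLabel i)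
      { s with log := b, log' := 0, reg := Function.update (0 : Fin 5 → ℕ) i.succ (a * b) } := by
    intro i a
    have h := run_mulOuter c i a b 0 s
    have h0 : Function.update (Function.update (0 : Fin 5 → ℕ) i.castSucc a) i.succ 0 =
        Function.update (0 : Fin 5 → ℕ) i.castSucc a := by
      rw [Function.update_comm (by simp [Fin.ext_iff])]
      congr 1
      exact Function.update_eq_self _ _
    rwa [h0, Nat.zero_add] at h
  have h := (((key 0 1).trans (key 1 (1 * b))).trans (key 2 (1 * b * b))).trans (key 3 (1 * b * b * b))
  rw [show 1 * b * b * b * b = b ^ 4 by ring] at h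
  refine h.mono (le_of_eq (by ring))

theorem run_buildInner (c n m : ℕ) (w : List Γ') (s : Store) :
    Run c (n + 1) Label.buildInner { s with log := n, log' := m, front := w } Label.buildRestore
      { s with log := 0, log' := m + n,
               front := Γ'.comma :: (List.replicate n (Γ'.bit false) ++ w) } := by
  induction n generalizing m w with
  | zero =>
    refine Run.of_step fun v => ⟨_, _, rfl, ?_⟩
    funext k
    cases k <;> rfl
  | succ n ih =>
    have h : Run c 1 Label.buildInner { s with log := n + 1, log' := m, front := w }
        Label.buildInner { s with log := n, log' := m + 1, front := Γ'.bit false :: w } := by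
      refine Run.of_step fun v => ⟨_, _, rfl, ?_⟩
      funext k
      cases k <;> rfl
    have := h.trans (ih (m + 1) (Γ'.bit false :: w))
    rw [show m + (n + 1) = m + 1 + n by omega, List.replicate_succ']
    simp only [List.append_assoc, List.singleton_append]
    exact this.mono (by omega)

theorem run_buildRestore (c n m : ℕ) (s : Store) :
    Run c (n + 1) Label.buildRestore { s with log := m, log' := n } Label.buildOuter
      { s with log := m + n, log' := 0 } := by
  induction n generalizing m with
  | zero =>
    refine Run.of_step fun v => ⟨_, _, rfl, ?_⟩
    funext k
    cases k <;> rfl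
  | succ n ih =>
    have h : Run c 1 Label.buildRestore { s with log := m, log' := n + 1 } Label.buildRestore
        { s with log := m + 1, log' := n } := by
      refine Run.of_step fun v => ⟨_, _, rfl, ?_⟩
      funext k
      cases k <;> rfl
    have := h.trans (ih (m + 1))
    rw [show m + (n + 1) = m + 1 + n by omega]
    exact this.mono (by omega)

theorem run_buildOuter (c b n m : ℕ) (s : Store) :
    Run c (n * (2 * b + 3) + 1) Label.buildOuter
      { s with cnt := n, log := b, log' := 0, front := template b m } Label.start
      { s with cnt := 0, log := b, log' := 0, front := template b (m + n) } := by
  induction n generalizing m with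
  | zero =>
    refine Run.mono (t₁ := 1) (Run.of_step fun v => ⟨_, _, rfl, ?_⟩) (by omega)
    funext k
    cases k <;> rfl
  | succ n ih =>
    have h : Run c 1 Label.buildOuter
        { s with cnt := n + 1, log := b, log' := 0, front := template b m } Label.buildInner
        { s with cnt := n, log := b, log' := 0, front := template b m } := by
      refine Run.of_step fun v => ⟨_, _, rfl, ?_⟩
      funext k
      cases k <;> rfl
    have := ((h.trans (run_buildInner c b 0 (template b m) { s with cnt := n })).trans
      (run_buildRestore c (0 + b) 0 { s with cnt := n, front := template b (m + 1) })).trans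
      (by simpa only [Nat.zero_add] using ih (m + 1))
    rw [show m + (n + 1) = m + 1 + n by omega]
    refine this.mono ?_
    rw [add_mul]
    omega

/-- The setup phase. -/
theorem run_setup (c N : ℕ) :
    Run c ((N + 1) + (Nat.log 2 N + 1) * (2 * N + 3) +
        ((((c * (Nat.log 2 N + 1)) ^ 3 + (c * (Nat.log 2 N + 1)) ^ 2 + c * (Nat.log 2 N + 1) + 1) *
          (2 * (c * (Nat.log 2 N + 1)) + 3)) + 4) +
        (N * (2 * (c * (Nat.log 2 N + 1)) + 3) + 1))
      Label.copy { inp := List.replicate N true } Label.start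
      { log := c * (Nat.log 2 N + 1), front := template (c * (Nat.log 2 N + 1)) N,
        reg := Function.update 0 4 ((c * (Nat.log 2 N + 1)) ^ 4) } := by
  have h1 := run_copy c N 0 {}
  have h2 := run_rounds c N { cnt := N, reg := Function.update 0 0 1 }
  have h3 := run_muls c (c * (Nat.log 2 N + 1)) { cnt := N }
  have h4 := run_buildOuter c (c * (Nat.log 2 N + 1)) N 0
    { reg := Function.update 0 4 ((c * (Nat.log 2 N + 1)) ^ 4) }
  simp only [Nat.zero_add] at h1 h2 h4
  exact ((h1.trans h2).trans h3).trans h4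

/-! ### Correctness of the enumeration loop -/

theorem run_read (c : ℕ) (f : Bool) {w : List Γ'} (hw : IsWord w) (v : List Γ') (s : Store) :
    Run c (w.length + 1) (Label.read f) { s with front := w, back := v } (Label.rewind true)
      { s with front := [], back := w.reverse ++ v, out := emit f w s.out } := by
  induction w generalizing f v s with
  | nil =>
    refine Run.of_step fun v => ⟨_, _, rfl, ?_⟩
    funext k
    cases k <;> rfl
  | cons x w ih =>
    have hw' : IsWord w := fun z hz => hw z (List.mem_cons_of_mem _ hz)
    rw [List.reverse_cons, List.append_assoc, List.singleton_append]
    rcases hw x List.mem_cons_self with rfl | ⟨b, rfl⟩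
    · have h : Run c 1 (Label.read f) { s with front := Γ'.comma :: w, back := v }
          (Label.read false)
          { s with front := w, back := Γ'.comma :: v, out := Γ'.comma :: s.out } := by
        refine Run.of_step fun v => ⟨_, _, rfl, ?_⟩
        funext k
        cases k <;> rfl
      have := h.trans (ih false hw' (Γ'.comma :: v) { s with out := Γ'.comma :: s.out })
      exact this.mono (by simp only [List.length_cons]; omega)
    · have h : Run c 1 (Label.read f) { s with front := Γ'.bit b :: w, back := v }
          (Label.read (f || b))
          { s with front := w, back := Γ'.bit b :: v,
                   out := if f || b then Γ'.bit b :: s.out else s.out } := by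
        refine Run.of_step fun v => ?_
        cases f <;> cases b
        all_goals
          refine ⟨_, _, rfl, ?_⟩
          funext k
          cases k <;> rfl
      have := h.trans (ih (f || b) hw' (Γ'.bit b :: v)
        { s with out := if f || b then Γ'.bit b :: s.out else s.out })
      exact this.mono (by simp only [List.length_cons]; omega)

theorem run_rewind_false (c : ℕ) (v w : List Γ') (s : Store) :
    Run c (v.length + 1) (Label.rewind false) { s with front := w, back := v } Label.start
      { s with front := v.reverse ++ w, back := [] } := by
  induction v generalizing w with
  | nil =>
    refine Run.of_step fun v => ⟨_, _, rfl, ?_⟩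
    funext k
    cases k <;> rfl
  | cons x v ih =>
    rw [List.reverse_cons, List.append_assoc, List.singleton_append]
    have h : Run c 1 (Label.rewind false) { s with front := w, back := x :: v }
        (Label.rewind false) { s with front := x :: w, back := v } := by
      refine Run.of_step fun v => ⟨_, _, rfl, ?_⟩
      funext k
      cases k <;> rfl
    exact (h.trans (ih (x :: w))).mono (by simp only [List.length_cons]; omega)

/-- The output after reading the words of a list one after the other. -/
def emitAll (L : List (List Γ')) (out : List Γ') : List Γ' :=
  L.foldl (fun out w => emit false w (Γ'.ket :: out)) out

theorem emitAll_append (L₁ L₂ : List (List Γ')) (out : List Γ') :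
    emitAll (L₁ ++ L₂) out = emitAll L₂ (emitAll L₁ out) :=
  List.foldl_append

theorem run_start (c : ℕ) {w : List Γ'} (hw : IsWord w) (s : Store) :
    Run c (w.length + 2) Label.start { s with front := w, back := [] } (Label.rewind true)
      { s with front := [], back := w.reverse, out := emitAll [w] s.out } := by
  have h : Run c 1 Label.start { s with front := w, back := [] } (Label.read false)
      { s with front := w, back := [], out := Γ'.ket :: s.out } := by
    refine Run.of_step fun v => ⟨_, _, rfl, ?_⟩
    funext k
    cases k <;> rfl
  have := h.trans (run_read c false hw [] { s with out := Γ'.ket :: s.out })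
  rw [List.append_nil] at this
  exact this.mono (by omega)

theorem isWord_append {v w : List Γ'} : IsWord (v ++ w) ↔ IsWord v ∧ IsWord w := by
  simp only [IsWord, List.mem_append, or_imp, forall_and]

/-- The enumeration loop visits all variants of the part of the word that starts out cleared. -/
theorem run_variants (c u : ℕ) {p w : List Γ'} (hp : IsWord p) (hw : IsWord w)
    (hclear : w.map clearBit = w) (s : Store) :
    Run c ((variants u w).length * ((p.length + w.length + 3) * (w.length + 1))) Label.start
      { s with front := p ++ w, back := [], reg := Function.update 0 4 u } (Label.rewind true)
      { s with front := w, back := p.reverse, reg := Function.update 0 4 u,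
               out := emitAll ((variants u w).map (p ++ ·)) s.out } := by
  -- The invariant that makes the recursion work: on return the suffix `w` is cleared again, the
  -- budget is back to `u`, and the head stands just after the prefix `p`.
  induction w generalizing u p s with
  | nil =>
    have h := run_start c hp { s with reg := Function.update 0 4 u }
    have hv : variants u [] = [[]] := by cases u <;> rfl
    rw [hv]
    simp only [List.map_cons, List.map_nil, List.append_nil]
    refine h.mono ?_
    simp
  | cons x w ih =>
    have hw' : IsWord w := fun z hz => hw z (List.mem_cons_of_mem _ hz)
    rw [List.map_cons, List.cons.injEq] at hclear
    have hpos := length_variants_pos u w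
    have hpx : ∀ y, (y = Γ'.comma ∨ ∃ b, y = Γ'.bit b) → IsWord (p ++ [y]) := fun y hy =>
      isWord_append.2 ⟨hp, by simpa [IsWord] using hy⟩
    rcases hw x List.mem_cons_self with rfl | ⟨b, rfl⟩
    · have h1 := ih u (hpx Γ'.comma (Or.inl rfl)) hw' hclear.2 s
      rw [List.reverse_append, List.reverse_singleton, List.singleton_append,
        List.append_assoc, List.singleton_append] at h1
      have h2 : Run c 1 (Label.rewind true)
          { s with front := w, back := Γ'.comma :: p.reverse, reg := Function.update 0 4 u,
                   out := emitAll ((variants u w).map (p ++ [Γ'.comma] ++ ·)) s.out }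
          (Label.rewind true)
          { s with front := Γ'.comma :: w, back := p.reverse, reg := Function.update 0 4 u,
                   out := emitAll ((variants u w).map (p ++ [Γ'.comma] ++ ·)) s.out } := by
        refine Run.of_step fun v => ⟨_, _, rfl, ?_⟩
        funext k
        cases k <;> rfl
      have hv : variants u (Γ'.comma :: w) = (variants u w).map (Γ'.comma :: ·) := by
        cases u <;> rfl
      have h3 := h1.trans h2
      rw [hv, List.map_map, List.length_map]
      simp only [List.append_assoc, List.singleton_append] at h3
      refine h3.mono ?_
      simp only [List.length_append, List.length_cons, List.length_nil]
      nlinarith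
    · have hb : b = false := by simpa [clearBit] using hclear.1.symm
      subst hb
      have h1 := ih u (hpx (Γ'.bit false) (Or.inr ⟨_, rfl⟩)) hw' hclear.2 s
      rw [List.reverse_append, List.reverse_singleton, List.singleton_append,
        List.append_assoc, List.singleton_append] at h1
      rcases u with _ | u
      · have h2 : Run c 1 (Label.rewind true)
            { s with front := w, back := Γ'.bit false :: p.reverse, reg := Function.update 0 4 0,
                     out := emitAll ((variants 0 w).map (p ++ [Γ'.bit false] ++ ·)) s.out }
            (Label.rewind true)
            { s with front := Γ'.bit false :: w, back := p.reverse, reg := Function.update 0 4 0,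
                     out := emitAll ((variants 0 w).map (p ++ [Γ'.bit false] ++ ·)) s.out } := by
          refine Run.of_step fun v => ⟨_, _, rfl, ?_⟩
          funext k
          cases k <;> try rfl
          rename_i i
          fin_cases i <;> rfl
        have h3 := h1.trans h2
        rw [variants, List.map_map, List.length_map]
        simp only [List.append_assoc, List.singleton_append] at h3
        refine h3.mono ?_
        simp only [List.length_append, List.length_cons, List.length_nil]
        nlinarith
      -- With budget left, the variants with this bit zero come first. Then the bit is set at the
      -- cost of one unit, the prefix is rewound, the variants with the bit one follow, and finally
      -- the bit is cleared and the unit refunded.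
      · set out₁ := emitAll ((variants (u + 1) w).map (p ++ [Γ'.bit false] ++ ·)) s.out with hout₁
        have h2 : Run c 1 (Label.rewind true)
            { s with front := w, back := Γ'.bit false :: p.reverse,
                     reg := Function.update 0 4 (u + 1), out := out₁ }
            (Label.rewind false)
            { s with front := Γ'.bit true :: w, back := p.reverse,
                     reg := Function.update 0 4 u, out := out₁ } := by
          refine Run.of_step fun v => ⟨_, _, rfl, ?_⟩
          funext k
          cases k <;> try rfl
          rename_i i
          fin_cases i <;> rfl
        have h3 := run_rewind_false c p.reverse (Γ'.bit true :: w)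
          { s with reg := Function.update 0 4 u, out := out₁ }
        rw [List.reverse_reverse] at h3
        have h4 := ih u (hpx (Γ'.bit true) (Or.inr ⟨_, rfl⟩)) hw' hclear.2 { s with out := out₁ }
        rw [List.reverse_append, List.reverse_singleton, List.singleton_append,
          List.append_assoc, List.singleton_append] at h4
        set out₂ := emitAll ((variants u w).map (p ++ [Γ'.bit true] ++ ·)) out₁ with hout₂
        have h5 : Run c 1 (Label.rewind true)
            { s with front := w, back := Γ'.bit true :: p.reverse,
                     reg := Function.update 0 4 u, out := out₂ }
            (Label.rewind true)
            { s with front := Γ'.bit false :: w, back := p.reverse,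
                     reg := Function.update 0 4 (u + 1), out := out₂ } := by
          refine Run.of_step fun v => ⟨_, _, rfl, ?_⟩
          funext k
          cases k <;> try rfl
          rename_i i
          fin_cases i <;> rfl
        have h6 := (((h1.trans h2).trans h3).trans h4).trans h5
        have hout : emitAll ((variants (u + 1) (Γ'.bit false :: w)).map (p ++ ·)) s.out = out₂ := by
          rw [variants, List.map_append, emitAll_append, List.map_map, List.map_map, hout₂, hout₁]
          simp only [List.append_assoc, List.singleton_append]
          rfl
        rw [hout]
        refine h6.mono ?_
        have hpos' := length_variants_pos u w
        simp only [variants, List.length_map, List.length_append, List.length_cons, List.length_nil, List.length_reverse]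
        generalize (variants u w).length = a at *
        generalize (variants (u + 1) w).length = b at *
        generalize p.length = q at *
        generalize w.length = r at *
        -- The last summand is the slack gained from the longer word; with at least two variants it
        -- covers flipping the bit and rewinding the prefix.
        have e : (b + a) * ((q + (r + 1) + 3) * (r + 1 + 1)) =
          b * ((q + (0 + 1) + r + 3) * (r + 1)) + a * ((q + (0 + 1) + r + 3) * (r + 1)) +
            (b + a) * (q + r + 4) := by ring
        rw [e]
        have : 2 * (q + r + 4) ≤ (b + a) * (q + r + 4) := Nat.mul_le_mul_right _ (by omega)
        omega

/-- The final configuration `haltList` demands that every stack but the output be empty. -/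
theorem run_clean (c b u : ℕ) (w out : List Γ') :
    Run c (w.length + u + b) Label.clean
      { log := b, front := w, reg := Function.update 0 4 u, out := out } Label.clean
      { out := out } := by
  induction w with
  | cons x w ih =>
    have h : Run c 1 Label.clean
        { log := b, front := x :: w, reg := Function.update 0 4 u, out := out } Label.clean
        { log := b, front := w, reg := Function.update 0 4 u, out := out } := by
      refine Run.of_step fun v => ⟨_, _, rfl, ?_⟩
      funext k
      cases k <;> rfl
    exact (h.trans ih).mono (by simp only [List.length_cons]; omega)
  | nil =>
    induction u with
    | succ u ih =>
      have h : Run c 1 Label.clean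
          { log := b, reg := Function.update 0 4 (u + 1), out := out } Label.clean
          { log := b, reg := Function.update 0 4 u, out := out } := by
        refine Run.of_step fun v => ⟨_, _, rfl, ?_⟩
        funext k
        cases k <;> try rfl
        rename_i i
        fin_cases i <;> rfl
      exact (h.trans ih).mono (by simp only [List.length_nil]; omega)
    | zero =>
      induction b with
      | succ b ih =>
        have h : Run c 1 Label.clean
            { log := b + 1, reg := Function.update 0 4 0, out := out } Label.clean
            { log := b, reg := Function.update 0 4 0, out := out } := by
          refine Run.of_step fun v => ⟨_, _, rfl, ?_⟩
          funext k
          cases k <;> try rfl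
          rename_i i
          fin_cases i <;> rfl
        exact (h.trans ih).mono (by omega)
      | zero =>
        have : (Function.update 0 4 0 : Fin 5 → ℕ) = 0 := Function.update_eq_self _ _
        rw [this]
        exact Run.refl _ _ _

theorem isWord_template (L N : ℕ) : IsWord (template L N) := by
  induction N with
  | zero => simp [template, IsWord]
  | succ N ih =>
    intro x hx
    simp only [template, List.mem_cons, List.mem_append, List.mem_replicate] at hx
    rcases hx with rfl | ⟨-, rfl⟩ | hx
    exacts [Or.inl rfl, Or.inr ⟨_, rfl⟩, ih x hx]

theorem map_clearBit_template (L N : ℕ) : (template L N).map clearBit = template L N := by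
  induction N with
  | zero => rfl
  | succ N ih => simp [template, ih, clearBit]

/-! ### The list written by the machine -/

/-- The number of binary digits of the coordinates. -/
def digitCount (c N : ℕ) : ℕ := c * (Nat.log 2 N + 1)

/-- The words of the points written by the machine. -/
def words (c N : ℕ) : List (List Γ') :=
  variants (digitCount c N ^ 4) (template (digitCount c N) N)

/-- A bound for the running time. -/
def runTime (c N : ℕ) : ℕ :=
  (N + 1) + (Nat.log 2 N + 1) * (2 * N + 3) +
    ((digitCount c N ^ 3 + digitCount c N ^ 2 + digitCount c N + 1) *
      (2 * digitCount c N + 3) + 4) + (N * (2 * digitCount c N + 3) + 1) +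
    (words c N).length * ((N * (digitCount c N + 1) + 3) * (N * (digitCount c N + 1) + 1)) +
    1 + (N * (digitCount c N + 1) + digitCount c N ^ 4 + digitCount c N) + 1

theorem iterate_step_program (c N : ℕ) (v : Option Γ') : ∃ n ≤ runTime c N,
    (flip bind (TM2.step (program c)))^[n]
      (some ⟨some Label.copy, v, ({ inp := List.replicate N true } : Store).stk⟩) =
    some ⟨none, none, ({ out := emitAll (words c N) [] } : Store).stk⟩ := by
  have h1 := run_setup c N
  have h2 := run_variants c (digitCount c N ^ 4) (p := []) (by simp [IsWord])
    (isWord_template (digitCount c N) N) (map_clearBit_template _ _) { log := digitCount c N }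
  have h3 : Run c 1 (Label.rewind true)
      { log := digitCount c N, front := template (digitCount c N) N,
        reg := Function.update 0 4 (digitCount c N ^ 4), out := emitAll (words c N) [] } Label.clean
      { log := digitCount c N, front := template (digitCount c N) N,
        reg := Function.update 0 4 (digitCount c N ^ 4), out := emitAll (words c N) [] } := by
    refine Run.of_step fun v => ⟨_, _, rfl, ?_⟩
    funext k
    cases k <;> rfl
  have h4 := run_clean c (digitCount c N) (digitCount c N ^ 4) (template (digitCount c N) N)
    (emitAll (words c N) [])
  simp only [List.nil_append, List.map_id', List.length_nil, Nat.zero_add, length_template,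
    List.reverse_nil] at h2 h4
  obtain ⟨v', n, hn, h⟩ := (((h1.trans h2).trans h3).trans h4) v
  -- The extra step is the one that halts, once the stacks are empty.
  refine ⟨1 + n, ?_, ?_⟩
  · rw [runTime, Nat.add_comm 1]
    exact Nat.succ_le_succ hn
  · rw [Function.iterate_add_apply, h]
    refine congrArg some ?_
    refine congrArg (TM2.Cfg.mk none none) ?_
    funext k
    cases k <;> try rfl
    rename_i i
    fin_cases i <;> rfl

/-- The leading comma opens a coordinate with value zero, which is the starting situation of
`emit_eq`. -/
theorem emit_eq_of_head {w : List Γ'} (hw : IsWord w) (h : w = [] ∨ ∃ v, w = Γ'.comma :: v)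
    (out : List Γ') :
    emit false w (Γ'.ket :: out) = encodePoint (decode w []) ++ out := by
  rcases h with rfl | ⟨v, rfl⟩
  · rfl
  · have hv : IsWord v := fun z hz => hw z (List.mem_cons_of_mem _ hz)
    have := emit_eq hv 0 [] (Γ'.ket :: out)
    simpa [emit, decode, encodePoint, encodeCoord, encodeNat, encodeNum] using this

theorem isWord_map_clearBit {w : List Γ'} (h : IsWord (w.map clearBit)) : IsWord w := by
  intro x hx
  have := h _ (List.mem_map_of_mem hx)
  rcases x with _ | b | _ | _ | _ <;> simp_all [clearBit]

/-- The points written by the machine. -/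
def points (c N : ℕ) : List (List ℕ) := ((words c N).map fun w => decode w []).reverse

theorem map_clearBit_of_mem_words {c N : ℕ} {w : List Γ'} (hw : w ∈ words c N) :
    w.map clearBit = template (digitCount c N) N := by
  rw [map_clearBit_of_mem_variants hw, map_clearBit_template]

/-- Later words end up on top of the output stack, whence the reversal in `points`. -/
theorem encodePoints_points (c N : ℕ) : encodePoints (points c N) = emitAll (words c N) [] := by
  have key : ∀ (L : List (List Γ')) (out : List Γ'),
      (∀ w ∈ L, w.map clearBit = template (digitCount c N) N) →
      emitAll L out = encodePoints ((L.map fun w => decode w []).reverse) ++ out := by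
    intro L
    induction L with
    | nil => intro out _; rfl
    | cons w L ih =>
      intro out h
      have h1 := h w List.mem_cons_self
      have hw : IsWord w := isWord_map_clearBit (by rw [h1]; exact isWord_template _ _)
      have hhead : w = [] ∨ ∃ v, w = Γ'.comma :: v := by
        rcases w with _ | ⟨x, v⟩
        · exact Or.inl rfl
        · refine Or.inr ⟨v, ?_⟩
          cases N with
          | zero => simp [template] at h1
          | succ N =>
            rw [template, List.map_cons, List.cons.injEq] at h1
            rcases x with _ | b | _ | _ | _ <;> simp_all [clearBit]
      change emitAll L (emit false w (Γ'.ket :: out)) = _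
      rw [ih _ fun v hv => h v (List.mem_cons_of_mem _ hv), emit_eq_of_head hw hhead]
      simp [encodePoints]
  rw [key _ _ fun w hw => map_clearBit_of_mem_words hw, List.append_nil]
  rfl

theorem count_comma_template (L N : ℕ) : (template L N).count Γ'.comma = N := by
  induction N with
  | zero => rfl
  | succ N ih => simp [template, List.count_replicate, ih]

theorem count_comma_map_clearBit (w : List Γ') :
    (w.map clearBit).count Γ'.comma = w.count Γ'.comma := by
  induction w with
  | nil => rfl
  | cons x w ih => rcases x with _ | b | _ | _ | _ <;> simp [clearBit, ih]

theorem length_of_mem_points {c N : ℕ} {l : List ℕ} (hl : l ∈ points c N) : l.length = N := by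
  obtain ⟨w, hw, rfl⟩ := List.mem_map.1 (List.mem_reverse.1 hl)
  rw [length_decode, ← count_comma_map_clearBit, map_clearBit_of_mem_words hw,
    count_comma_template]
  rfl

/-- The points written by the machine, as functions. -/
def hitters (c N : ℕ) : List (Fin N → ℕ) := (points c N).map fun l i => l.getD i 0

theorem map_ofFn_hitters (c N : ℕ) : (hitters c N).map List.ofFn = points c N := by
  rw [hitters, List.map_map]
  refine (List.map_congr_left fun l hl => ?_).trans (List.map_id _)
  have h := length_of_mem_points hl
  refine List.ext_getElem (by simp [h]) fun i h1 h2 => ?_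
  have h3 : i < l.length := h2
  simp [h3]

theorem length_hitters (c N : ℕ) : (hitters c N).length = (words c N).length := by
  simp [hitters, points]

/-- The machine. -/
def machine (c : ℕ) : FinTM2 where
  K := Stack
  k₀ := Stack.inp
  k₁ := Stack.out
  Γ := Alphabet
  Λ := Label
  main := Label.copy
  σ := Option Γ'
  initialState := none
  Γk₀Fin := inferInstanceAs (Fintype Bool)
  m := program c

theorem unaryEncodeNat_eq (N : ℕ) : unaryEncodeNat N = List.replicate N true := by
  induction N with
  | zero => rfl
  | succ N ih => rw [unaryEncodeNat, ih, List.replicate_succ]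

theorem machine_outputs (c N : ℕ) : ∃ n ≤ runTime c N,
    (flip bind (machine c).step)^[n]
      (some (initList (machine c) (List.map (Equiv.refl Bool).invFun (unaryEncodeNat N)))) =
    some (haltList (machine c) (List.map (Equiv.refl Γ').invFun
      (encodePoints ((hitters c N).map List.ofFn)))) := by
  obtain ⟨n, hn, h⟩ := iterate_step_program c N none
  refine ⟨n, hn, ?_⟩
  have h1 : initList (machine c) (List.map (Equiv.refl Bool).invFun (unaryEncodeNat N)) =
      ⟨some Label.copy, none, ({ inp := List.replicate N true } : Store).stk⟩ := by
    refine congrArg (TM2.Cfg.mk (some Label.copy) none) ?_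
    rw [unaryEncodeNat_eq]
    funext k
    cases k <;> try rfl
    exact List.map_id _
  have h2 : haltList (machine c) (List.map (Equiv.refl Γ').invFun
      (encodePoints ((hitters c N).map List.ofFn))) =
      ⟨none, none, ({ out := emitAll (words c N) [] } : Store).stk⟩ := by
    refine congrArg (TM2.Cfg.mk none none) ?_
    rw [map_ofFn_hitters, encodePoints_points]
    funext k
    cases k <;> try rfl
    exact List.map_id _
  rw [h1, h2]
  exact h

/-- The list of points is computable within the time bound. -/
noncomputable def computable (c : ℕ) : TM2ComputableInTime unaryEncodeNat encodePoints
    (fun N : ℕ => (hitters c N).map List.ofFn) where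
  tm := machine c
  inputAlphabet := Equiv.refl Bool
  outputAlphabet := Equiv.refl Γ'
  time := runTime c
  outputsFun N :=
    { steps := (machine_outputs c N).choose
      evals_in_steps := (machine_outputs c N).choose_spec.2
      steps_le_m := (machine_outputs c N).choose_spec.1.trans
        (le_of_eq (by rw [unaryEncodeNat_eq, List.length_replicate])) }

/-- The word of `x` has at most `L` ones per nonzero coordinate, so it stays within the budget
`L^4`, where `L = digitCount c N`. -/
theorem mem_hitters {c N : ℕ} {x : Fin N → ℕ} (hx : ∀ i, x i < 2 ^ digitCount c N)
    (hcard : (Finset.univ.filter fun i => x i ≠ 0).card * digitCount c N ≤ digitCount c N ^ 4) :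
    x ∈ hitters c N := by
  have hcount : (List.ofFn x).countP (fun y => y ≠ 0) =
      (Finset.univ.filter fun i => x i ≠ 0).card := by
    rw [List.ofFn_eq_map, List.countP_map, List.countP_eq_length_filter]
    rfl
  have hw : word (digitCount c N) (List.ofFn x) ∈ words c N := by
    have := mem_variants (s := word (digitCount c N) (List.ofFn x)) (u := digitCount c N ^ 4)
      ((count_word_le _ _).trans (by rw [hcount]; exact hcard))
    rwa [map_clearBit_word, List.length_ofFn] at this
  refine List.mem_map.2 ⟨List.ofFn x, List.mem_reverse.2 (List.mem_map.2 ⟨_, hw, ?_⟩), ?_⟩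
  · refine decode_word fun y hy => ?_
    obtain ⟨i, rfl⟩ := (List.mem_ofFn' _ _).1 hy
    exact hx i
  · funext i
    simp

/-! ### Running time and size bounds -/

theorem runTime_le {c : ℕ} (hc : 1 ≤ c) (N : ℕ) :
    runTime c N ≤ (N + digitCount c N + 2) ^ (2 * digitCount c N ^ 4 + 9) := by
  have hlog : Nat.log 2 N + 1 ≤ digitCount c N := Nat.le_mul_of_pos_left _ hc
  have hW : (words c N).length ≤ (N * (digitCount c N + 1) + 1) ^ (digitCount c N ^ 4) := by
    have := length_variants_le (digitCount c N ^ 4) (template (digitCount c N) N)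
    rwa [length_template] at this
  have hW1 : 1 ≤ (words c N).length := length_variants_pos _ _
  rw [runTime]
  generalize (words c N).length = W at *
  generalize digitCount c N = L at *
  generalize Nat.log 2 N + 1 = ℓ at *
  obtain ⟨M, hM⟩ : ∃ M, M = N + L + 2 := ⟨_, rfl⟩
  rw [← hM]
  have hM2 : 2 ≤ M := by omega
  have hNL : N * (L + 1) + 1 ≤ M ^ 2 := by rw [hM]; nlinarith
  have hWM : W ≤ M ^ (2 * L ^ 4) := by
    rw [pow_mul]
    exact hW.trans (Nat.pow_le_pow_left hNL _)
  have hsq : 2 * M ≤ M ^ 2 := by nlinarith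
  have hcube : M ^ 2 * 2 ≤ M ^ 3 := by rw [pow_succ M 2]; gcongr
  have hfour : M ^ 3 * 2 ≤ M ^ 4 := by rw [pow_succ M 3]; gcongr
  have t1 : ℓ * (2 * N + 3) ≤ 2 * M ^ 2 := by
    calc ℓ * (2 * N + 3) ≤ M * (2 * M) := Nat.mul_le_mul (by omega) (by omega)
      _ = _ := by ring
  have t2 : (L ^ 3 + L ^ 2 + L + 1) * (2 * L + 3) ≤ 2 * M ^ 4 := by
    have : L ^ 3 + L ^ 2 + L + 1 ≤ M ^ 3 := by
      calc L ^ 3 + L ^ 2 + L + 1 ≤ (L + 2) ^ 3 := by ring_nf; nlinarith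
        _ ≤ M ^ 3 := Nat.pow_le_pow_left (by omega) 3
    calc (L ^ 3 + L ^ 2 + L + 1) * (2 * L + 3) ≤ M ^ 3 * (2 * M) :=
          Nat.mul_le_mul this (by omega)
      _ = _ := by ring
  have t3 : N * (2 * L + 3) ≤ 2 * M ^ 2 := by
    calc N * (2 * L + 3) ≤ M * (2 * M) := Nat.mul_le_mul (by omega) (by omega)
      _ = _ := by ring
  have t4 : (N * (L + 1) + 3) * (N * (L + 1) + 1) ≤ 2 * M ^ 4 := by
    calc (N * (L + 1) + 3) * (N * (L + 1) + 1) ≤ (2 * M ^ 2) * M ^ 2 :=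
          Nat.mul_le_mul (by omega) hNL
      _ = _ := by ring
  have t5 : L ^ 4 ≤ M ^ 4 := Nat.pow_le_pow_left (by omega) 4
  have t6 : W * ((N * (L + 1) + 3) * (N * (L + 1) + 1)) ≤ W * (2 * M ^ 4) :=
    Nat.mul_le_mul_left _ t4
  have t7 : 30 * M ^ 4 ≤ W * (30 * M ^ 4) := Nat.le_mul_of_pos_left _ hW1
  calc _ ≤ 30 * M ^ 4 + W * (2 * M ^ 4) := by omega
    _ ≤ W * (30 * M ^ 4) + W * (2 * M ^ 4) := Nat.add_le_add_right t7 _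
    -- As `M` is at least `2`, the factor `2^5` is absorbed by `M^5`; hence the `9` in the exponent.
    _ = W * (2 ^ 5 * M ^ 4) := by ring
    _ ≤ M ^ (2 * L ^ 4) * (M ^ 5 * M ^ 4) := by gcongr
    _ = M ^ (2 * L ^ 4 + 9) := by rw [← pow_add, ← pow_add]

/-- The base is `exp(O(log N))` and the exponent `O((log N)^4)`, which gives the fifth power. -/
theorem runTime_le_exp {c : ℕ} (hc : 1 ≤ c) {N : ℕ} (hN : 2 ≤ N) :
    (runTime c N : ℝ) ≤
      Real.exp ((4 * c + 5) * (2 * (4 * c) ^ 4 + 144) * Real.log N ^ 5) := by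
  have hN0 : (0 : ℝ) < N := by positivity
  set x := Real.log N with hx
  have h2 : Real.log 2 ≤ x := Real.log_le_log two_pos (by exact_mod_cast hN)
  have hx1 : 1 ≤ 2 * x := by linarith [Real.log_two_gt_d9]
  have hlog : (Nat.log 2 N : ℝ) ≤ 2 * x := by
    have h1 : ((2 : ℝ) ^ Nat.log 2 N) ≤ N := by exact_mod_cast Nat.pow_log_le_self 2 (by omega)
    have h3 := Real.log_le_log (by positivity) h1
    rw [Real.log_pow] at h3
    nlinarith [Real.log_two_gt_d9, (Nat.cast_nonneg (Nat.log 2 N) : (0 : ℝ) ≤ _)]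
  have hL : (digitCount c N : ℝ) ≤ 4 * c * x := by
    rw [digitCount]
    push_cast
    nlinarith [(Nat.cast_nonneg c : (0 : ℝ) ≤ _)]
  have hM : ((N + digitCount c N + 2 : ℕ) : ℝ) ≤ Real.exp ((4 * c + 5) * x) := by
    push_cast
    have hy : (digitCount c N : ℝ) + 2 ≤ (4 * c + 4) * x := by nlinarith
    calc (N : ℝ) + digitCount c N + 2 ≤ N * (1 + (digitCount c N + 2)) := by
          have : (1 : ℝ) ≤ N := by exact_mod_cast (by omega : 1 ≤ N)
          nlinarith [(Nat.cast_nonneg (digitCount c N) : (0 : ℝ) ≤ _)]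
      _ ≤ Real.exp x * Real.exp ((4 * c + 4) * x) := by
          rw [hx, Real.exp_log hN0, ← hx]
          gcongr
          linarith [Real.add_one_le_exp ((4 * c + 4) * x)]
      _ = _ := by rw [← Real.exp_add]; ring_nf
  -- Here `144 = 9 * 2^4`, since `1 ≤ (2 * x)^4`.
  have he : ((2 * digitCount c N ^ 4 + 9 : ℕ) : ℝ) ≤ (2 * (4 * c) ^ 4 + 144) * x ^ 4 := by
    push_cast
    have h4 : (1 : ℝ) ≤ (2 * x) ^ 4 := one_le_pow₀ hx1
    have h5 : (digitCount c N : ℝ) ^ 4 ≤ (4 * c * x) ^ 4 := by gcongr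
    calc 2 * (digitCount c N : ℝ) ^ 4 + 9 ≤ 2 * (4 * c * x) ^ 4 + 9 * (2 * x) ^ 4 := by linarith
      _ = _ := by ring
  calc (runTime c N : ℝ) ≤ ((N + digitCount c N + 2 : ℕ) : ℝ) ^ (2 * digitCount c N ^ 4 + 9) := by
        exact_mod_cast runTime_le hc N
    _ ≤ Real.exp ((4 * c + 5) * x) ^ (2 * digitCount c N ^ 4 + 9) := by gcongr
    _ = Real.exp (((2 * digitCount c N ^ 4 + 9 : ℕ) : ℝ) * ((4 * c + 5) * x)) :=
        (Real.exp_nat_mul _ _).symm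
    _ ≤ Real.exp (((2 * (4 * c) ^ 4 + 144) * x ^ 4) * ((4 * c + 5) * x)) := by
        have : 0 ≤ x := by linarith
        gcongr
    _ = _ := by ring_nf

theorem card_le_runTime (c N : ℕ) : (words c N).length ≤ runTime c N := by
  rw [runTime]
  have : (words c N).length ≤ (words c N).length *
      ((N * (digitCount c N + 1) + 3) * (N * (digitCount c N + 1) + 1)) :=
    Nat.le_mul_of_pos_right _ (by positivity)
  omega

/-- One number `digitCount c N` serves both as digit length, since it bounds the degree, and as
order of derivation, since it bounds the top fan-in. The condition `5 ≤ c` is for the support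
estimate of the final proof. -/
theorem exists_eval_lt_two_pow (p : Polynomial ℕ) :
    ∃ c, 5 ≤ c ∧ ∀ N, p.eval N < 2 ^ digitCount c N := by
  refine ⟨p.eval 1 + p.natDegree + 5, by omega, fun N => ?_⟩
  set ℓ := Nat.log 2 N + 1 with hℓ
  have h1 : p.eval N ≤ p.eval 1 * (2 ^ ℓ) ^ p.natDegree := by
    rw [Polynomial.eval_eq_sum_range, Polynomial.eval_eq_sum_range, Finset.sum_mul]
    refine Finset.sum_le_sum fun i hi => ?_
    rw [one_pow, mul_one]
    refine Nat.mul_le_mul_left _ ?_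
    calc N ^ i ≤ (2 ^ ℓ) ^ i := Nat.pow_le_pow_left (Nat.lt_pow_succ_log_self one_lt_two N).le i
      _ ≤ _ := Nat.pow_le_pow_right (by positivity) (Nat.lt_succ_iff.1 (Finset.mem_range.1 hi))
  calc p.eval N ≤ p.eval 1 * (2 ^ ℓ) ^ p.natDegree := h1
    _ < 2 ^ p.eval 1 * (2 ^ ℓ) ^ p.natDegree := by
        gcongr
        exact Nat.lt_two_pow_self
    _ = 2 ^ (p.eval 1 + ℓ * p.natDegree) := by rw [← pow_mul, ← pow_add]
    _ ≤ 2 ^ digitCount (p.eval 1 + p.natDegree + 5) N := by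
        refine Nat.pow_le_pow_right two_pos ?_
        rw [digitCount, ← hℓ]
        have : 1 ≤ ℓ := by omega
        nlinarith

/-- This rests on `2 < e`; for `N = 0` the convention `Real.log 0 = 0` forces `k = 0`. -/
theorem le_natLog_of_le_log {k N : ℕ} (h : (k : ℝ) ≤ Real.log N) : k ≤ Nat.log 2 N := by
  rcases Nat.eq_zero_or_pos N with rfl | hN
  · simpa using h
  · refine Nat.le_log_of_pow_le one_lt_two ?_
    have h1 : (2 : ℝ) ^ k ≤ Real.exp 1 ^ k := by
      gcongr
      linarith [Real.exp_one_gt_d9]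
    rw [← Real.exp_nat_mul, mul_one] at h1
    have h2 := h1.trans (Real.exp_le_exp.2 h)
    rw [Real.exp_log (by exact_mod_cast hN)] at h2
    exact_mod_cast h2

end SparseEnum

/-! ### The hitting set -/

/-- `p` is the polynomial bound on the size and the degree. On input `N` (in unary) a multi-stack
Turing machine writes down the list `H N` of points of `ℕ ^ N`, in at most `M.time N` steps. -/
theorem theorem1p8 :
    ∃ B : ℕ, ∀ p : Polynomial ℕ, ∃ (A : ℝ) (H : (N : ℕ) → List (Fin N → ℕ))
      (M : Turing.TM2ComputableInTime Computability.unaryEncodeNat encodePoints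
        (fun N : ℕ => (H N).map List.ofFn)),
      (∀ N : ℕ, 2 ≤ N → (M.time N : ℝ) ≤ Real.exp (A * Real.log N ^ B)) ∧
      ∀ (F : Type*) [Field F] [CharZero F] (N : ℕ),
        (2 ≤ N → ((pointSet F (H N)).card : ℝ) ≤ Real.exp (A * Real.log N ^ B)) ∧
        ∀ k d : ℕ, (k : ℝ) ≤ Real.log N → (d : ℝ) ≤ Real.log N →
          IsHittingSet (pointSet F (H N) : Set (Fin N → F))
            {P | P ∈ sigmaPiSigmaPi F N k d (p.eval N) ∧ P.totalDegree ≤ p.eval N} := by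
  refine ⟨5, fun p => ?_⟩
  obtain ⟨c, hc, hp⟩ := SparseEnum.exists_eval_lt_two_pow p
  refine ⟨(4 * c + 5) * (2 * (4 * c) ^ 4 + 144), SparseEnum.hitters c, SparseEnum.computable c,
    fun N hN => SparseEnum.runTime_le_exp (by omega) hN, fun F _ _ N => ⟨fun hN => ?_, ?_⟩⟩
  · refine le_trans ?_ (SparseEnum.runTime_le_exp (c := c) (by omega) hN)
    refine Nat.cast_le.2 (le_trans ?_ (SparseEnum.card_le_runTime c N))
    rw [← SparseEnum.length_hitters]
    classical
    exact (List.toFinset_card_le _).trans (List.length_map _).le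
  · rintro k d hk hd P ⟨hP, hdeg⟩ h0
    obtain ⟨x, hx, hcard, hxP⟩ := exists_sparse_point hP hdeg h0 (hp N)
    refine ⟨fun i => (x i : F), ?_, hxP⟩
    have hmem : x ∈ SparseEnum.hitters c N := by
      refine SparseEnum.mem_hitters (fun i => (hx i).trans_lt (hp N)) ?_
      have hk' := SparseEnum.le_natLog_of_le_log hk
      have hd' := SparseEnum.le_natLog_of_le_log hd
      -- Derivatives of order `L = digitCount c N` leave at most `L * L^2` nonzero coordinates,
      -- hence at most `L^4` ones.
      have hq : 6 * (k + 1) * (2 * d + 3) + 1 ≤ SparseEnum.digitCount c N ^ 2 := by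
        set ℓ := Nat.log 2 N + 1 with hℓ
        calc 6 * (k + 1) * (2 * d + 3) + 1 ≤ 6 * ℓ * (2 * ℓ + 1) + 1 := by
              gcongr ?_ + 1
              exact Nat.mul_le_mul (Nat.mul_le_mul_left 6 (by omega)) (by omega)
          _ ≤ (5 * ℓ) ^ 2 := by nlinarith [show 1 ≤ ℓ by omega]
          _ ≤ SparseEnum.digitCount c N ^ 2 :=
            Nat.pow_le_pow_left (Nat.mul_le_mul_right _ hc) 2
      calc _ ≤ SparseEnum.digitCount c N * SparseEnum.digitCount c N ^ 2 *
            SparseEnum.digitCount c N :=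
              Nat.mul_le_mul_right _ (hcard.trans (Nat.mul_le_mul_left _ hq))
        _ = _ := by ring
    classical
    simp only [pointSet, List.coe_toFinset, Set.mem_ofPred_eq]
    exact List.mem_map_of_mem (f := fun x i => (x i : F)) hmem
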